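/- A relational schema $\mathbf S=\mathbf S_h\cup\mathbf S_v$ consists of finitely many relation names, each with an arity $\ge 0$, partitioned into hidden ($\mathbf S_h$) and visible ($\mathbf S_v$) ones. Fix a countably infinite domain of values; every constant is identified with its value, so distinct constants denote distinct values (unique name assumption). An instance $\mathcal F$ of $\mathbf S$ is a finite set of facts $R(a_1,\dots,a_k)$ with $R\in\mathbf S$ of arity $k$; $\mathsf{Visible}(\mathcal F)$ is its restriction to the relations in $\mathbf S_v$. A linear TGD (with constants) is a sentence $\forall\bar x\,(\phi(\bar x)\to\exists\bar y\,\rho(\bar x,\bar y))$, where $\phi$ and $\rho$ are single relational atoms that may contain constants and repeated variables, and all variables $\bar x$ occur in $\phi$. A Boolean CQ is an existentially closed conjunction of relational atoms, which may contain constants. For a Boolean CQ $Q$ over $\mathbf S$, a finite set $\mathcal C$ of linear TGDs over $\mathbf S$, and an instance $\mathcal V$ of $\mathbf S_v$, let $\mathsf{PQI}(Q,\mathcal C,\mathbf S,\mathcal V)=\mathsf{true}$ if every (finite) instance $\mathcal F$ of $\mathbf S$ with $\mathcal F\models\mathcal C$ and $\mathsf{Visible}(\mathcal F)=\mathcal V$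 satisfies $Q$. The instance $\mathcal V$ is realizable w.r.t. $\mathcal C$ if there is at least one (finite) instance $\mathcal F$ of $\mathbf S$ with $\mathcal F\models\mathcal C$ and $\mathsf{Visible}(\mathcal F)=\mathcal V$. Let $\exists\mathsf{PQI}(Q,\mathcal C,\mathbf S)=\mathsf{true}$ if there is a realizable (finite) instance $\mathcal V$ of $\mathbf S_v$ with $\mathsf{PQI}(Q,\mathcal C,\mathbf S,\mathcal V)=\mathsf{true}$. Corollary. The problem $\exists\mathsf{PQI}$ is undecidable for Boolean CQs and linear TGDs with constants: there is no algorithm that, given a schema $\mathbf S$, a finite set $\mathcal C$ of linear TGDs (with constants) over $\mathbf S$, and a Boolean CQ $Q$ over $\mathbf S$, decides whether $\exists\mathsf{PQI}(Q,\mathcal C,\mathbf S)=\mathsf{true}$. -/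

import Mathlib

namespace PQIProblem

/-- A term: `Sum.inl x` is the variable `x`, and `Sum.inr c` is the constant `c`.
Variables are named by natural numbers.  The domain of values is the countably infinite set `ℕ`,
and every constant is identified with its value, so that distinct constants denote distinct values
(unique name assumption). -/
abbrev Term : Type := ℕ ⊕ ℕ

/-- A relational atom `R(t₁, …, tₖ)`: the relation name and the list of its arguments. -/
abbrev Atom : Type := ℕ × List Term

/-- A ground fact `R(a₁, …, aₖ)`: the relation name and a tuple of values. -/
abbrev Fact : Type := ℕ × List ℕ

/-- A relational schema: a finite list of relations.  The relation at position `R` of the list has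
name `R`; its entry is its arity together with a flag, `true` for a visible relation and `false`
for a hidden one. -/
abbrev Schema : Type := List (ℕ × Bool)

/-- A linear TGD `∀ x̄ (φ(x̄) → ∃ ȳ ρ(x̄, ȳ))` with one body atom `φ` (first component) and one head
atom `ρ` (second component).  The universally quantified variables `x̄` are those of the body; the
variables of the head that are not in the body are the existentially quantified `ȳ`.  Constants and
repeated variables are allowed in both atoms. -/
abbrev LinearTGD : Type := Atom × Atom

/-- A Boolean conjunctive query: the list of its atoms, all variables being existentially
quantified.  Constants and repeated variables are allowed. -/
abbrev BooleanCQ : Type := List Atom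

/-- `R` is a relation of the schema `S`, of arity `k`. -/
def Schema.HasArity (S : Schema) (R k : ℕ) : Prop := ∃ v : Bool, S[R]? = some (k, v)

/-- `R` is a visible relation of the schema `S`. -/
def Schema.IsVisible (S : Schema) (R : ℕ) : Prop := ∃ k : ℕ, S[R]? = some (k, true)

/-- The atom is an atom over the schema `S`. -/
def Atom.IsOver (a : Atom) (S : Schema) : Prop := S.HasArity a.1 a.2.length

/-- The linear TGD is a constraint over the schema `S`. -/
def LinearTGD.IsOver (d : LinearTGD) (S : Schema) : Prop :=
  Atom.IsOver d.1 S ∧ Atom.IsOver d.2 S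

/-- The Boolean CQ is a query over the schema `S`. -/
def BooleanCQ.IsOver (Q : BooleanCQ) (S : Schema) : Prop := ∀ a ∈ Q, Atom.IsOver a S

/-- A (finite) instance of the schema `S`, given as the finite set of its facts. -/
structure FinInstance (S : Schema) where
  facts : Finset Fact
  isOver : ∀ f ∈ facts, S.HasArity f.1 f.2.length

/-- A (finite) instance of the visible part of the schema `S`. -/
structure VisibleInstance (S : Schema) where
  facts : Finset Fact
  isOver : ∀ f ∈ facts, S.HasArity f.1 f.2.length
  isVisible : ∀ f ∈ facts, S.IsVisible f.1

open Classical in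
/-- `Visible(F)`: the restriction of the instance `F` to the visible relations. -/
noncomputable def FinInstance.visible {S : Schema} (F : FinInstance S) : VisibleInstance S where
  facts := F.facts.filter (fun f => S.IsVisible f.1)
  isOver := fun f hf => F.isOver f (Finset.mem_filter.mp hf).1
  isVisible := fun _ hf => (Finset.mem_filter.mp hf).2

/-- The value of a term under an assignment `σ` of values to variables. -/
def Term.eval (σ : ℕ → ℕ) : Term → ℕ
  | Sum.inl x => σ x
  | Sum.inr c => c

/-- The fact obtained from an atom under an assignment of values to variables. -/
def Atom.eval (σ : ℕ → ℕ) (a : Atom) : Fact := (a.1, a.2.map (Term.eval σ))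

/-- The instance `F` satisfies the linear TGD: every assignment that makes the body true in `F`
can be changed outside the variables of the body so as to make the head true in `F`. -/
def FinInstance.SatTGD {S : Schema} (F : FinInstance S) (d : LinearTGD) : Prop :=
  ∀ σ : ℕ → ℕ, Atom.eval σ d.1 ∈ F.facts →
    ∃ τ : ℕ → ℕ, (∀ x : ℕ, Sum.inl x ∈ d.1.2 → τ x = σ x) ∧ Atom.eval τ d.2 ∈ F.facts

/-- The instance `F` satisfies all constraints of the finite set `C`. -/
def FinInstance.Sat {S : Schema} (F : FinInstance S) (C : List LinearTGD) : Prop :=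
  ∀ d ∈ C, F.SatTGD d

/-- The Boolean CQ `Q` is true in the instance `F`. -/
def FinInstance.SatCQ {S : Schema} (F : FinInstance S) (Q : BooleanCQ) : Prop :=
  ∃ σ : ℕ → ℕ, ∀ a ∈ Q, Atom.eval σ a ∈ F.facts

/-- `PQI(Q, C, S, V) = true`. -/
def PQI (Q : BooleanCQ) (C : List LinearTGD) (S : Schema) (V : VisibleInstance S) : Prop :=
  ∀ F : FinInstance S, F.Sat C → V = F.visible → F.SatCQ Q

/-- The visible instance `V` is realizable with respect to `C`. -/
def Realizable (C : List LinearTGD) (S : Schema) (V : VisibleInstance S) : Prop :=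
  ∃ F : FinInstance S, F.Sat C ∧ V = F.visible

/-- `∃PQI(Q, C, S) = true`. -/
def ExistsPQI (Q : BooleanCQ) (C : List LinearTGD) (S : Schema) : Prop :=
  ∃ V : VisibleInstance S, Realizable C S V ∧ PQI Q C S V

end PQIProblem

/-! ### Challenges: universal rules enforced by hidden relations. -/

namespace PQIProblem

/-! The halting problem is reduced to `ExistsPQI`. The visible instance acts as a certificate of a
halting run, and the hidden relations act as an adversary looking for an error in it.

Linear TGDs cannot state a rule whose body is a conjunction, but the universal quantifier over
hidden parts can. For each rule, the flag forces some hidden challenge tuple, and each challenge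
tuple forces every body atom separately; all body variables occur in the tuple, so the atoms share
one assignment. The query asks that each rule have a challenge that is answered by its head. If the
query holds for every hidden part, it holds when a rule has a single, arbitrarily chosen challenge,
so the rule holds at every match. Conversely, a hidden part always contains some challenge, and true
rules answer it. This is `existsPQI_challenge_iff`. Each rule must then have some match; dummy
all-zero rows, marked `1` in their first column, supply one without affecting the genuine rows,
marked `0`.

Programs of `Turing.ToPartrec.Code` are presented as finite call graphs, with `fix` turned into a
cycle. Ten rules say that each recorded run is reduced to runs of smaller rank. On a finite set a
transitive irreflexive order is well founded, so a recorded run is a genuine halting computation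
even if the certificate has superfluous rows (`sound_of_isRunModel`). Conversely, a halting
computation has a finite ranked derivation (`derivable_of_mem_eval`), whose rows satisfy the rules
(`isRunModel_certRel`). -/

/-- A rule on the tuples of one relation: the body atoms (given by their argument lists) entail
the head atoms, after the universally quantified variables `0, 1, …` have been unified with the
terms of `pattern`. -/
structure ChallengeRule where
  body : List (List Term)
  pattern : List Term
  head : List (List Term)

namespace ChallengeRule

/-- All body atoms hold in `T` under the assignment `σ`. -/
def Matches (T : Finset (List ℕ)) (ρ : ChallengeRule) (σ : ℕ → ℕ) : Prop :=
  ∀ a ∈ ρ.body, a.map (Term.eval σ) ∈ T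

/-- The rule, with `u` universally quantified variables, holds in `T`. -/
def Holds (u : ℕ) (T : Finset (List ℕ)) (ρ : ChallengeRule) : Prop :=
  ∀ σ : ℕ → ℕ, ρ.Matches T σ → ∃ τ : ℕ → ℕ,
    ρ.pattern.map (Term.eval τ) = (List.range u).map σ ∧ ∀ a ∈ ρ.head, a.map (Term.eval τ) ∈ T

end ChallengeRule

/-- Renaming the variables of a term to their `i`-th copies. -/
def Term.rename (i : ℕ) : Term → Term := Sum.map (Nat.pair i) id

/-- The list of the variables `0, …, u - 1`. -/
def varList (u : ℕ) : List Term := (List.range u).map Sum.inl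

/-- The schema with a visible flag `0` of arity `0`, a visible relation `1` of arity `k`, and one
hidden challenge relation of arity `u` for each of `m` rules. -/
def challengeSchema (k u m : ℕ) : Schema :=
  (0, true) :: (k, true) :: List.replicate m (u, false)

/-- The query: the flag is set, and every challenge is answered as its rule requires. -/
def challengeQuery (ρs : List ChallengeRule) : BooleanCQ :=
  (0, []) :: ρs.zipIdx.flatMap fun p =>
    (p.2 + 2, p.1.pattern.map (Term.rename p.2)) ::
      p.1.head.map fun a => (1, a.map (Term.rename p.2))

/-- The constraints: every rule is challenged at some match of its body. -/
def challengeConstraints (u : ℕ) (ρs : List ChallengeRule) : List LinearTGD :=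
  ρs.zipIdx.flatMap fun p =>
    ((0, []), (p.2 + 2, varList u)) :: p.1.body.map fun a => ((p.2 + 2, varList u), (1, a))

/-- The constraints requiring that each atom of `D` has a match. -/
def demandConstraints (D : List (List Term)) : List LinearTGD := D.map fun a => ((0, []), (1, a))

section

variable {k u : ℕ} {ρs : List ChallengeRule} {D : List (List Term)}

theorem hasArity_flag {m l : ℕ} : (challengeSchema k u m).HasArity 0 l ↔ l = 0 := by
  simp [Schema.HasArity, challengeSchema, eq_comm]

theorem hasArity_tuple {m l : ℕ} : (challengeSchema k u m).HasArity 1 l ↔ l = k := by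
  simp [Schema.HasArity, challengeSchema, eq_comm]

theorem hasArity_challenge {m i l : ℕ} :
    (challengeSchema k u m).HasArity (i + 2) l ↔ i < m ∧ l = u := by
  simp [Schema.HasArity, challengeSchema, List.getElem?_replicate, eq_comm]

theorem isVisible_iff {m R : ℕ} : (challengeSchema k u m).IsVisible R ↔ R < 2 := by
  match R with
  | 0 => simp [Schema.IsVisible, challengeSchema]
  | 1 => simp [Schema.IsVisible, challengeSchema]
  | i + 2 => simp [Schema.IsVisible, challengeSchema, List.getElem?_replicate]

theorem Term.eval_rename (i : ℕ) (σ : ℕ → ℕ) (t : Term) :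
    Term.eval σ (Term.rename i t) = Term.eval (fun x => σ (Nat.pair i x)) t := by
  cases t <;> rfl

theorem map_eval_rename (i : ℕ) (σ : ℕ → ℕ) (l : List Term) :
    (l.map (Term.rename i)).map (Term.eval σ) = l.map (Term.eval fun x => σ (Nat.pair i x)) := by
  simp [Term.eval_rename]

theorem map_eval_varList (σ : ℕ → ℕ) : (varList u).map (Term.eval σ) = (List.range u).map σ := by
  simp [varList, Term.eval]

theorem challengeQuery_isOver (h : ∀ ρ ∈ ρs, ρ.pattern.length = u ∧ ∀ a ∈ ρ.head, a.length = k) :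
    (challengeQuery ρs).IsOver (challengeSchema k u ρs.length) := by
  intro a ha
  rcases List.mem_cons.1 ha with rfl | ha
  · exact hasArity_flag.2 rfl
  obtain ⟨⟨ρ, i⟩, hp, ha⟩ := List.mem_flatMap.1 ha
  rw [List.mem_zipIdx_iff_getElem?] at hp
  have hρ := h ρ (List.mem_of_getElem? hp)
  rcases List.mem_cons.1 ha with rfl | ha
  · exact hasArity_challenge.2 ⟨(List.getElem?_eq_some_iff.1 hp).1, by simpa using hρ.1⟩
  · obtain ⟨b, hb, rfl⟩ := List.mem_map.1 ha
    exact hasArity_tuple.2 (by simpa using hρ.2 b hb)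

theorem challengeConstraints_isOver (h : ∀ ρ ∈ ρs, ∀ a ∈ ρ.body, a.length = k) :
    ∀ d ∈ challengeConstraints u ρs, d.IsOver (challengeSchema k u ρs.length) := by
  intro d hd
  obtain ⟨⟨ρ, i⟩, hp, hd⟩ := List.mem_flatMap.1 hd
  rw [List.mem_zipIdx_iff_getElem?] at hp
  have hρ := h ρ (List.mem_of_getElem? hp)
  have hi : (challengeSchema k u ρs.length).HasArity (i + 2) (varList u).length :=
    hasArity_challenge.2 ⟨(List.getElem?_eq_some_iff.1 hp).1, by simp [varList]⟩
  rcases List.mem_cons.1 hd with rfl | hd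
  · exact ⟨hasArity_flag.2 rfl, hi⟩
  · obtain ⟨b, hb, rfl⟩ := List.mem_map.1 hd
    exact ⟨hi, hasArity_tuple.2 (hρ b hb)⟩

theorem demandConstraints_isOver {m : ℕ} (h : ∀ a ∈ D, a.length = k) :
    ∀ d ∈ demandConstraints D, d.IsOver (challengeSchema k u m) := by
  intro d hd
  obtain ⟨b, hb, rfl⟩ := List.mem_map.1 hd
  exact ⟨hasArity_flag.2 rfl, hasArity_tuple.2 (h b hb)⟩

open Classical in
/-- The instance with the flag, the tuples of `T`, and rule `j` challenged at `s j` only. -/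
noncomputable def challengeInstance (u m : ℕ) (T : Finset (List ℕ)) (hT : ∀ l ∈ T, l.length = k)
    (s : ℕ → ℕ → ℕ) : FinInstance (challengeSchema k u m) where
  facts := {(0, [])} ∪ T.image (fun l => (1, l)) ∪
    (Finset.range m).image fun j => (j + 2, (List.range u).map (s j))
  isOver := by
    intro f hf
    simp only [Finset.mem_union, Finset.mem_singleton, Finset.mem_image, Finset.mem_range] at hf
    rcases hf with (rfl | ⟨l, hl, rfl⟩) | ⟨j, hj, rfl⟩
    · exact hasArity_flag.2 rfl
    · exact hasArity_tuple.2 (hT l hl)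
    · exact hasArity_challenge.2 ⟨hj, by simp⟩

section

variable {m : ℕ} {T : Finset (List ℕ)} {hT : ∀ l ∈ T, l.length = k} {s : ℕ → ℕ → ℕ}

theorem flag_mem_challengeInstance : (0, []) ∈ (challengeInstance u m T hT s).facts := by
  simp [challengeInstance]

theorem tuple_mem_challengeInstance {l : List ℕ} :
    (1, l) ∈ (challengeInstance u m T hT s).facts ↔ l ∈ T := by
  simp [challengeInstance]

theorem challenge_mem_challengeInstance {i : ℕ} {l : List ℕ} :
    (i + 2, l) ∈ (challengeInstance u m T hT s).facts ↔ i < m ∧ l = (List.range u).map (s i) := by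
  simp only [challengeInstance]
  simp [@eq_comm _ _ l]

/-- Rule `i` has only one challenge, so a challenge atom can match only with the values `s i`, and
these satisfy the body. -/
theorem challengeInstance_sat {s : ℕ → ℕ → ℕ}
    (hs : ∀ i (ρ : ChallengeRule), ρs[i]? = some ρ → ρ.Matches T (s i))
    (hD : ∀ a ∈ D, ∃ σ : ℕ → ℕ, a.map (Term.eval σ) ∈ T) :
    (challengeInstance u ρs.length T hT s).Sat
      (challengeConstraints u ρs ++ demandConstraints D) := by
  intro d hd σ hσ
  rcases List.mem_append.1 hd with hd | hd
  · obtain ⟨⟨ρ, i⟩, hp, hd⟩ := List.mem_flatMap.1 hd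
    rw [List.mem_zipIdx_iff_getElem?] at hp
    have hi := (List.getElem?_eq_some_iff.1 hp).1
    rcases List.mem_cons.1 hd with rfl | hd
    · exact ⟨s i, by simp, challenge_mem_challengeInstance.2 ⟨hi, map_eval_varList _⟩⟩
    · obtain ⟨b, hb, rfl⟩ := List.mem_map.1 hd
      have h1 := (challenge_mem_challengeInstance.1 hσ).2
      rw [map_eval_varList] at h1
      refine ⟨s i, fun x hx => ?_, tuple_mem_challengeInstance.2 (hs i ρ hp b hb)⟩
      simp only [varList, List.mem_map, List.mem_range, Sum.inl.injEq, exists_eq_right] at hx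
      exact (List.map_inj_left.1 h1 x (List.mem_range.2 hx)).symm
  · obtain ⟨b, hb, rfl⟩ := List.mem_map.1 hd
    obtain ⟨τ, hτ⟩ := hD b hb
    exact ⟨τ, by simp, tuple_mem_challengeInstance.2 hτ⟩

theorem mem_visible {S : Schema} {F : FinInstance S} {f : Fact} :
    f ∈ F.visible.facts ↔ f ∈ F.facts ∧ S.IsVisible f.1 := by
  simp [FinInstance.visible]

theorem VisibleInstance.ext_facts {S : Schema} {V W : VisibleInstance S}
    (h : ∀ f, f ∈ V.facts ↔ f ∈ W.facts) : V = W := by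
  cases V; cases W
  congr
  exact Finset.ext h

theorem visible_eq_challengeInstance_visible
    {F : FinInstance (challengeSchema k u m)} (h0 : (0, []) ∈ F.facts)
    (hF : ∀ l, (1, l) ∈ F.facts ↔ l ∈ T) :
    F.visible = (challengeInstance u m T hT s).visible := by
  refine VisibleInstance.ext_facts fun f => ?_
  rw [mem_visible, mem_visible, and_congr_left_iff, isVisible_iff]
  obtain ⟨R, l⟩ := f
  intro hR
  match R, hR with
  | 0, _ =>
    have key : ∀ G : FinInstance (challengeSchema k u m), (0, l) ∈ G.facts → l = [] :=
      fun G h => List.length_eq_zero_iff.1 (hasArity_flag.1 (G.isOver _ h))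
    constructor
    · intro h; rw [key _ h]; exact flag_mem_challengeInstance
    · intro h; rw [key _ h]; exact h0
  | 1, _ => rw [hF, tuple_mem_challengeInstance]

end

theorem facts_iff_of_visible_eq {S : Schema} {F G : FinInstance S} (h : F.visible = G.visible)
    {f : Fact} (hf : S.IsVisible f.1) : f ∈ F.facts ↔ f ∈ G.facts := by
  have := (mem_visible (F := F) (f := f)).symm.trans (h ▸ mem_visible (F := G) (f := f))
  simpa [hf] using this

/-- The bound `hu` places every body variable in the challenge tuple; this prevents the separate
TGDs for the body atoms from choosing different witnesses. -/
theorem exists_matches_of_sat {m : ℕ} {F : FinInstance (challengeSchema k u m)}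
    {C : List LinearTGD} (hF : F.Sat (challengeConstraints u ρs ++ C)) (h0 : (0, []) ∈ F.facts)
    {i : ℕ} {ρ : ChallengeRule} (hi : ρs[i]? = some ρ)
    (hu : ∀ a ∈ ρ.body, ∀ x, Sum.inl x ∈ a → x < u) :
    ∃ σ : ℕ → ℕ, (i + 2, (List.range u).map σ) ∈ F.facts ∧
      ∀ a ∈ ρ.body, (1, a.map (Term.eval σ)) ∈ F.facts := by
  have hmem : ∀ d ∈ (((0, []), (i + 2, varList u)) ::
      ρ.body.map fun a => ((i + 2, varList u), (1, a)) : List LinearTGD), F.SatTGD d := by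
    intro d hd
    refine hF d (List.mem_append_left _ (List.mem_flatMap.2 ⟨(ρ, i), ?_, hd⟩))
    exact List.mem_zipIdx_iff_getElem?.2 hi
  obtain ⟨σ, -, hσ⟩ := hmem _ List.mem_cons_self (fun _ => 0) (by simpa [Atom.eval] using h0)
  refine ⟨σ, by simpa [Atom.eval, map_eval_varList] using hσ, fun a ha => ?_⟩
  obtain ⟨τ, h1, h2⟩ := hmem _ (List.mem_cons_of_mem _ (List.mem_map.2 ⟨a, ha, rfl⟩)) σ hσ
  have : a.map (Term.eval σ) = a.map (Term.eval τ) := by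
    refine List.map_congr_left fun t ht => ?_
    rcases t with x | c
    · exact (h1 x (by simpa [varList] using hu a ha x ht)).symm
    · rfl
  rw [this]
  exact h2

/-- The variables of different rules are renamed apart by `Nat.pair`, so one assignment for the
query amounts to an independent assignment for each rule. -/
theorem satCQ_challengeQuery_iff {m : ℕ} {F : FinInstance (challengeSchema k u m)} :
    F.SatCQ (challengeQuery ρs) ↔ (0, []) ∈ F.facts ∧ ∀ i ρ, ρs[i]? = some ρ →
      ∃ τ : ℕ → ℕ, (i + 2, ρ.pattern.map (Term.eval τ)) ∈ F.facts ∧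
        ∀ a ∈ ρ.head, (1, a.map (Term.eval τ)) ∈ F.facts := by
  constructor
  · rintro ⟨σ, hσ⟩
    refine ⟨by simpa [Atom.eval] using hσ _ List.mem_cons_self, fun i ρ hi => ?_⟩
    have hmem : ∀ a ∈ ((i + 2, ρ.pattern.map (Term.rename i)) ::
        ρ.head.map fun a => (1, a.map (Term.rename i)) : List Atom), Atom.eval σ a ∈ F.facts := by
      intro a ha
      refine hσ a (List.mem_cons_of_mem _ (List.mem_flatMap.2 ⟨(ρ, i), ?_, ha⟩))
      exact List.mem_zipIdx_iff_getElem?.2 hi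
    refine ⟨fun x => σ (Nat.pair i x), ?_, fun a ha => ?_⟩
    · have := hmem _ List.mem_cons_self
      rwa [Atom.eval, map_eval_rename] at this
    · have := hmem _ (List.mem_cons_of_mem _ (List.mem_map.2 ⟨a, ha, rfl⟩))
      rwa [Atom.eval, map_eval_rename] at this
  · rintro ⟨h0, h⟩
    have h' : ∀ i, ∃ τ : ℕ → ℕ, ∀ ρ, ρs[i]? = some ρ →
        (i + 2, ρ.pattern.map (Term.eval τ)) ∈ F.facts ∧
        ∀ a ∈ ρ.head, (1, a.map (Term.eval τ)) ∈ F.facts := by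
      intro i
      rcases hi : ρs[i]? with _ | ρ
      · exact ⟨fun _ => 0, by simp⟩
      · obtain ⟨τ, hτ⟩ := h i ρ hi
        refine ⟨τ, ?_⟩
        rintro _ ⟨⟩
        exact hτ
    choose τ hτ using h'
    refine ⟨fun n => τ n.unpair.1 n.unpair.2, fun a ha => ?_⟩
    rcases List.mem_cons.1 ha with rfl | ha
    · exact h0
    obtain ⟨⟨ρ, i⟩, hp, ha⟩ := List.mem_flatMap.1 ha
    obtain ⟨h1, h2⟩ := hτ i ρ (List.mem_zipIdx_iff_getElem?.1 hp)
    rcases List.mem_cons.1 ha with rfl | ha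
    · rw [Atom.eval, map_eval_rename]; simpa using h1
    · obtain ⟨b, hb, rfl⟩ := List.mem_map.1 ha
      rw [Atom.eval, map_eval_rename]; simpa using h2 b hb

/-- `∃PQI` for the challenge query and constraints says that some finite set of tuples satisfies
the rules non-vacuously and meets the demands. -/
theorem existsPQI_challenge_iff
    (hu : ∀ ρ ∈ ρs, ∀ a ∈ ρ.body, ∀ x, Sum.inl x ∈ a → x < u) :
    ExistsPQI (challengeQuery ρs) (challengeConstraints u ρs ++ demandConstraints D)
        (challengeSchema k u ρs.length) ↔
      ∃ T : Finset (List ℕ), (∀ l ∈ T, l.length = k) ∧ (∀ ρ ∈ ρs, ρ.Holds u T) ∧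
        (∀ ρ ∈ ρs, ∃ σ, ρ.Matches T σ) ∧ ∀ a ∈ D, ∃ σ : ℕ → ℕ, a.map (Term.eval σ) ∈ T := by
  classical
  constructor
  · rintro ⟨V, ⟨F, hF, rfl⟩, hV⟩
    have h0 : (0, []) ∈ F.facts := (satCQ_challengeQuery_iff.1 (hV F hF rfl)).1
    set T : Finset (List ℕ) := (F.facts.filter (·.1 = 1)).image (·.2) with hTdef
    have hFT : ∀ l, (1, l) ∈ F.facts ↔ l ∈ T := by
      intro l
      simp [T]
    have hT : ∀ l ∈ T, l.length = k := fun l hl => hasArity_tuple.1 (F.isOver _ ((hFT l).2 hl))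
    have hmatch : ∀ i : ℕ, ∃ σ : ℕ → ℕ, ∀ ρ : ChallengeRule, ρs[i]? = some ρ → ρ.Matches T σ := by
      intro i
      rcases hi : ρs[i]? with _ | ρ
      · exact ⟨fun _ => 0, by simp⟩
      · obtain ⟨σ, -, hσ⟩ := exists_matches_of_sat hF h0 hi (hu ρ (List.mem_of_getElem? hi))
        refine ⟨σ, ?_⟩
        rintro _ ⟨⟩ a ha
        exact (hFT _).1 (hσ a ha)
    have hD : ∀ a ∈ D, ∃ σ : ℕ → ℕ, a.map (Term.eval σ) ∈ T := by
      intro a ha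
      obtain ⟨τ, -, hτ⟩ := hF _ (List.mem_append_right _ (List.mem_map.2 ⟨a, ha, rfl⟩))
        (fun _ => 0) (by simpa [Atom.eval] using h0)
      exact ⟨τ, (hFT _).1 hτ⟩
    choose s hs using hmatch
    refine ⟨T, hT, fun ρ hρ σ hσ => ?_, fun ρ hρ => ?_, hD⟩
    · obtain ⟨i, hi⟩ := List.getElem?_of_mem hρ
      -- The adversary's move: rule `i` is challenged at the given match `σ` only. The visible part
      -- is unchanged, so the query must still hold.
      have hs' : ∀ j (ρ' : ChallengeRule), ρs[j]? = some ρ' →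
          ρ'.Matches T (Function.update s i σ j) := by
        intro j ρ' hj
        rcases eq_or_ne j i with rfl | hji
        · rw [hi] at hj; cases hj
          simpa using hσ
        · simpa [hji] using hs j ρ' hj
      have := hV (challengeInstance u ρs.length T hT (Function.update s i σ))
        (challengeInstance_sat hs' hD) (visible_eq_challengeInstance_visible h0 hFT)
      obtain ⟨τ, h1, h2⟩ := (satCQ_challengeQuery_iff.1 this).2 i ρ hi
      refine ⟨τ, ?_, fun a ha => tuple_mem_challengeInstance.1 (h2 a ha)⟩
      simpa using (challenge_mem_challengeInstance.1 h1).2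
    · obtain ⟨i, hi⟩ := List.getElem?_of_mem hρ
      exact ⟨s i, hs i ρ hi⟩
  · rintro ⟨T, hT, hrules, hmatch, hD⟩
    have hmatch' : ∀ i : ℕ, ∃ σ : ℕ → ℕ, ∀ ρ : ChallengeRule, ρs[i]? = some ρ → ρ.Matches T σ := by
      intro i
      rcases hi : ρs[i]? with _ | ρ
      · exact ⟨fun _ => 0, by simp⟩
      · obtain ⟨σ, hσ⟩ := hmatch ρ (List.mem_of_getElem? hi)
        refine ⟨σ, ?_⟩
        rintro _ ⟨⟩
        exact hσ
    choose s hs using hmatch'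
    refine ⟨_, ⟨challengeInstance u ρs.length T hT s, challengeInstance_sat hs hD, rfl⟩,
      fun F hF hFV => satCQ_challengeQuery_iff.2 ?_⟩
    have h0 : (0, []) ∈ F.facts :=
      (facts_iff_of_visible_eq hFV (isVisible_iff.2 (by simp))).1 flag_mem_challengeInstance
    have hFT : ∀ l, (1, l) ∈ F.facts ↔ l ∈ T := fun l =>
      (facts_iff_of_visible_eq hFV (isVisible_iff.2 (by simp))).symm.trans
        tuple_mem_challengeInstance
    refine ⟨h0, fun i ρ hi => ?_⟩
    have hρ := List.mem_of_getElem? hi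
    obtain ⟨σ, h1, h2⟩ := exists_matches_of_sat hF h0 hi (hu ρ hρ)
    obtain ⟨τ, h3, h4⟩ := hrules ρ hρ σ fun a ha => (hFT _).1 (h2 a ha)
    exact ⟨τ, h3 ▸ h1, fun a ha => (hFT _).2 (h4 a ha)⟩

end

end PQIProblem

/-! ### Rules describing correct program runs. -/

namespace PQIProblem

/-- Arguments after the tag, padded with zeros: a number and its successor; head, tail and list;
rank, label, input and output of a run; two ranks in increasing order; and, for instructions, a
label followed by the labels it calls. -/
abbrev tagSucc : ℕ := 0
abbrev tagPair : ℕ := 1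
abbrev tagRun : ℕ := 2
abbrev tagLt : ℕ := 3
abbrev tagZeroI : ℕ := 4
abbrev tagSuccI : ℕ := 5
abbrev tagTailI : ℕ := 6
abbrev tagConsI : ℕ := 7
abbrev tagCompI : ℕ := 8
abbrev tagCaseI : ℕ := 9

/-- The number of universally quantified variables available to each rule. -/
abbrev numVars : ℕ := 10

/-- An atom whose first argument is the variable `0`, and whose second argument is a tag. -/
def row (t : ℕ) (a b c d : Term) : List Term := [Sum.inl 0, Sum.inr t, a, b, c, d]

section

local notation "x_" => (Sum.inl : ℕ → Term)
local notation "zero_" => (Sum.inr 0 : Term)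

/-- In all rules variable `0` is the flag shared by body and head, and variables from `10` on are
existential. -/
def zeroRule : ChallengeRule where
  body := [row tagRun (x_ 1) (x_ 2) (x_ 3) (x_ 4), row tagZeroI (x_ 2) zero_ zero_ zero_]
  pattern := varList numVars
  head := [row tagPair zero_ (x_ 3) (x_ 4) zero_]

def succRule : ChallengeRule where
  body := [row tagRun (x_ 1) (x_ 2) (x_ 3) (x_ 4), row tagSuccI (x_ 2) zero_ zero_ zero_,
    row tagPair (x_ 5) (x_ 6) (x_ 3) zero_]
  pattern := varList numVars
  head := [row tagSucc (x_ 5) (x_ 10) zero_ zero_, row tagPair (x_ 10) zero_ (x_ 4) zero_]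

/-- Equality is expressed by the pattern: putting variable `4` in place `6` lets a challenge be
answered only if its entries `4` and `6` agree. -/
def tailRule : ChallengeRule where
  body := [row tagRun (x_ 1) (x_ 2) (x_ 3) (x_ 4), row tagTailI (x_ 2) zero_ zero_ zero_,
    row tagPair (x_ 5) (x_ 6) (x_ 3) zero_]
  pattern := (varList numVars).set 6 (x_ 4)
  head := []

def consRule : ChallengeRule where
  body := [row tagRun (x_ 1) (x_ 2) (x_ 3) (x_ 4), row tagConsI (x_ 2) (x_ 5) (x_ 6) zero_]
  pattern := varList numVars
  head := [row tagLt (x_ 10) (x_ 1) zero_ zero_, row tagLt (x_ 11) (x_ 1) zero_ zero_,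
    row tagRun (x_ 10) (x_ 5) (x_ 3) (x_ 12), row tagRun (x_ 11) (x_ 6) (x_ 3) (x_ 13),
    row tagPair (x_ 14) (x_ 15) (x_ 12) zero_, row tagPair (x_ 14) (x_ 13) (x_ 4) zero_]

def compRule : ChallengeRule where
  body := [row tagRun (x_ 1) (x_ 2) (x_ 3) (x_ 4), row tagCompI (x_ 2) (x_ 5) (x_ 6) zero_]
  pattern := varList numVars
  head := [row tagLt (x_ 10) (x_ 1) zero_ zero_, row tagLt (x_ 11) (x_ 1) zero_ zero_,
    row tagRun (x_ 10) (x_ 6) (x_ 3) (x_ 12), row tagRun (x_ 11) (x_ 5) (x_ 12) (x_ 4)]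

def caseZeroRule : ChallengeRule where
  body := [row tagRun (x_ 1) (x_ 2) (x_ 3) (x_ 4), row tagCaseI (x_ 2) (x_ 5) (x_ 6) zero_,
    row tagPair zero_ (x_ 7) (x_ 3) zero_]
  pattern := varList numVars
  head := [row tagLt (x_ 10) (x_ 1) zero_ zero_, row tagRun (x_ 10) (x_ 5) (x_ 7) (x_ 4)]

def caseSuccRule : ChallengeRule where
  body := [row tagRun (x_ 1) (x_ 2) (x_ 3) (x_ 4), row tagCaseI (x_ 2) (x_ 5) (x_ 6) zero_,
    row tagPair (x_ 8) (x_ 7) (x_ 3) zero_, row tagSucc (x_ 9) (x_ 8) zero_ zero_]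
  pattern := varList numVars
  head := [row tagPair (x_ 9) (x_ 7) (x_ 11) zero_, row tagLt (x_ 10) (x_ 1) zero_ zero_,
    row tagRun (x_ 10) (x_ 6) (x_ 11) (x_ 4)]

def headUniqueRule : ChallengeRule where
  body := [row tagPair (x_ 1) (x_ 2) (x_ 5) zero_, row tagPair (x_ 3) (x_ 4) (x_ 5) zero_]
  pattern := (varList numVars).set 3 (x_ 1)
  head := []

def ltTransRule : ChallengeRule where
  body := [row tagLt (x_ 1) (x_ 2) zero_ zero_, row tagLt (x_ 2) (x_ 3) zero_ zero_]
  pattern := varList numVars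
  head := [row tagLt (x_ 1) (x_ 3) zero_ zero_]

/-- Only rows whose flag is `1` may violate irreflexivity. -/
def ltIrreflRule : ChallengeRule where
  body := [row tagLt (x_ 1) (x_ 1) zero_ zero_]
  pattern := (varList numVars).set 0 (Sum.inr 1)
  head := []

end

/-- The rules stating that every run recorded in the visible relation is a correct one. -/
def runRules : List ChallengeRule :=
  [zeroRule, succRule, tailRule, consRule, compRule, caseZeroRule, caseSuccRule, headUniqueRule,
    ltTransRule, ltIrreflRule]

/-- The meaning of `runRules` for the relations `G t`, where `t` is a tag. -/
structure IsRunModel (G : ℕ → ℕ → ℕ → ℕ → ℕ → Prop) : Prop where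
  zero : ∀ r c v w, G tagRun r c v w → G tagZeroI c 0 0 0 → G tagPair 0 v w 0
  succ : ∀ r c v w h t, G tagRun r c v w → G tagSuccI c 0 0 0 → G tagPair h t v 0 →
    ∃ k, G tagSucc h k 0 0 ∧ G tagPair k 0 w 0
  tail : ∀ r c v w h t, G tagRun r c v w → G tagTailI c 0 0 0 → G tagPair h t v 0 → w = t
  cons : ∀ r c v w f g, G tagRun r c v w → G tagConsI c f g 0 → ∃ r₁ r₂ a b h t,
    G tagLt r₁ r 0 0 ∧ G tagLt r₂ r 0 0 ∧ G tagRun r₁ f v a ∧ G tagRun r₂ g v b ∧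
      G tagPair h t a 0 ∧ G tagPair h b w 0
  comp : ∀ r c v w f g, G tagRun r c v w → G tagCompI c f g 0 → ∃ r₁ r₂ a,
    G tagLt r₁ r 0 0 ∧ G tagLt r₂ r 0 0 ∧ G tagRun r₁ g v a ∧ G tagRun r₂ f a w
  case_zero : ∀ r c v w f g t, G tagRun r c v w → G tagCaseI c f g 0 → G tagPair 0 t v 0 →
    ∃ r₁, G tagLt r₁ r 0 0 ∧ G tagRun r₁ f t w
  case_succ : ∀ r c v w f g h t y, G tagRun r c v w → G tagCaseI c f g 0 → G tagPair h t v 0 →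
    G tagSucc y h 0 0 → ∃ r₁ a, G tagPair y t a 0 ∧ G tagLt r₁ r 0 0 ∧ G tagRun r₁ g a w
  head_unique : ∀ h t h' t' v, G tagPair h t v 0 → G tagPair h' t' v 0 → h = h'
  lt_trans : ∀ a b c, G tagLt a b 0 0 → G tagLt b c 0 0 → G tagLt a c 0 0
  lt_irrefl : ∀ a, ¬ G tagLt a a 0 0

theorem runRules_vars : ∀ ρ ∈ runRules, ∀ a ∈ ρ.body, ∀ x, Sum.inl x ∈ a → x < numVars := by
  simp [runRules, zeroRule, succRule, tailRule, consRule, compRule, caseZeroRule, caseSuccRule,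
    headUniqueRule, ltTransRule, ltIrreflRule, row, numVars]

theorem runRules_body_length : ∀ ρ ∈ runRules, ∀ a ∈ ρ.body, a.length = 6 := by
  simp [runRules, zeroRule, succRule, tailRule, consRule, compRule, caseZeroRule, caseSuccRule,
    headUniqueRule, ltTransRule, ltIrreflRule, row]

theorem runRules_head_length :
    ∀ ρ ∈ runRules, ρ.pattern.length = numVars ∧ ∀ a ∈ ρ.head, a.length = 6 := by
  simp [runRules, zeroRule, succRule, tailRule, consRule, compRule, caseZeroRule, caseSuccRule,
    headUniqueRule, ltTransRule, ltIrreflRule, row, varList]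

theorem isRunModel_of_holds {T : Finset (List ℕ)} (hT : ∀ ρ ∈ runRules, ρ.Holds numVars T) :
    IsRunModel fun t a b c d => [0, t, a, b, c, d] ∈ T := by
  simp only [runRules, List.mem_cons, List.not_mem_nil, or_false, forall_eq_or_imp,
    forall_eq] at hT
  obtain ⟨h1, h2, h3, h4, h5, h6, h7, h8, h9, h10⟩ := hT
  constructor
  · intro r c v w e1 e2
    -- Entry `0` of the list is the flag of genuine rows; universal variables absent from the body
    -- get the default `0`.
    obtain ⟨τ, p, q⟩ := h1 (fun i => [0, r, c, v, w].getD i 0)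
      (by simp [ChallengeRule.Matches, zeroRule, row, Term.eval, e1, e2])
    simp [zeroRule, row, Term.eval, varList, List.range_succ] at p q
    simp_all
  · intro r c v w h t e1 e2 e3
    obtain ⟨τ, p, q⟩ := h2 (fun i => [0, r, c, v, w, h, t].getD i 0)
      (by simp [ChallengeRule.Matches, succRule, row, Term.eval, e1, e2, e3])
    simp [succRule, row, Term.eval, varList, List.range_succ] at p q
    simp only [p] at q
    exact ⟨_, q⟩
  · intro r c v w h t e1 e2 e3
    obtain ⟨τ, p, q⟩ := h3 (fun i => [0, r, c, v, w, h, t].getD i 0)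
      (by simp [ChallengeRule.Matches, tailRule, row, Term.eval, e1, e2, e3])
    simp [tailRule, Term.eval, varList, List.range_succ] at p
    obtain ⟨_, _, _, _, p4, _, p6, _⟩ := p
    exact p4.symm.trans p6
  · intro r c v w f g e1 e2
    obtain ⟨τ, p, q⟩ := h4 (fun i => [0, r, c, v, w, f, g].getD i 0)
      (by simp [ChallengeRule.Matches, consRule, row, Term.eval, e1, e2])
    simp [consRule, row, Term.eval, varList, List.range_succ] at p q
    simp only [p] at q
    exact ⟨_, _, _, _, _, _, q⟩
  · intro r c v w f g e1 e2
    obtain ⟨τ, p, q⟩ := h5 (fun i => [0, r, c, v, w, f, g].getD i 0)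
      (by simp [ChallengeRule.Matches, compRule, row, Term.eval, e1, e2])
    simp [compRule, row, Term.eval, varList, List.range_succ] at p q
    simp only [p] at q
    exact ⟨_, _, _, q⟩
  · intro r c v w f g t e1 e2 e3
    obtain ⟨τ, p, q⟩ := h6 (fun i => [0, r, c, v, w, f, g, t].getD i 0)
      (by simp [ChallengeRule.Matches, caseZeroRule, row, Term.eval, e1, e2, e3])
    simp [caseZeroRule, row, Term.eval, varList, List.range_succ] at p q
    simp only [p] at q
    exact ⟨_, q⟩
  · intro r c v w f g h t y e1 e2 e3 e4
    obtain ⟨τ, p, q⟩ := h7 (fun i => [0, r, c, v, w, f, g, t, h, y].getD i 0)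
      (by simp [ChallengeRule.Matches, caseSuccRule, row, Term.eval, e1, e2, e3, e4])
    simp [caseSuccRule, row, Term.eval, varList, List.range_succ] at p q
    simp only [p] at q
    exact ⟨_, _, q⟩
  · intro h t h' t' v e1 e2
    obtain ⟨τ, p, q⟩ := h8 (fun i => [0, h, t, h', t', v].getD i 0)
      (by simp [ChallengeRule.Matches, headUniqueRule, row, Term.eval, e1, e2])
    simp [headUniqueRule, Term.eval, varList, List.range_succ] at p
    obtain ⟨_, p1, _, p3, _⟩ := p
    exact p1.symm.trans p3
  · intro a b c e1 e2
    obtain ⟨τ, p, q⟩ := h9 (fun i => [0, a, b, c].getD i 0)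
      (by simp [ChallengeRule.Matches, ltTransRule, row, Term.eval, e1, e2])
    simp [ltTransRule, row, Term.eval, varList, List.range_succ] at p q
    simp_all
  · intro a e1
    obtain ⟨τ, p, q⟩ := h10 (fun i => [0, a].getD i 0)
      (by simp [ChallengeRule.Matches, ltIrreflRule, row, Term.eval, e1])
    -- The pattern would force the flag `0` to equal `1`.
    simp [ltIrreflRule, Term.eval, varList, List.range_succ] at p

/-- The assignment extending `σ` by the values `l` for the variables that are not universal. -/
def extend (σ : ℕ → ℕ) (l : List ℕ) (i : ℕ) : ℕ :=
  if i < numVars then σ i else l.getD (i - numVars) 0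

/-- A match has a single flag. With flag `0` the model supplies the witnesses; with flag `1` all
matched values are zero, and zero witnesses suffice because every all-zero row is present. -/
theorem holds_of_isRunModel {G : ℕ → ℕ → ℕ → ℕ → ℕ → Prop} (hG : IsRunModel G)
    {T : Finset (List ℕ)}
    (hT : ∀ f t a b c d, [f, t, a, b, c, d] ∈ T ↔
      (f = 0 ∧ G t a b c d) ∨ (f = 1 ∧ t < 10 ∧ a = 0 ∧ b = 0 ∧ c = 0 ∧ d = 0)) :
    ∀ ρ ∈ runRules, ρ.Holds numVars T := by
  simp only [runRules, List.mem_cons, List.not_mem_nil, or_false, forall_eq_or_imp,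
    forall_eq]
  refine ⟨?_, ?_, ?_, ?_, ?_, ?_, ?_, ?_, ?_, ?_⟩ <;> intro σ hσ
  · simp only [ChallengeRule.Matches, zeroRule, row, Term.eval,
      List.forall_mem_cons, List.map_cons,
      List.map_nil, hT] at hσ
    by_cases hf : σ 0 = 0
    · simp [hf] at hσ
      have e := hG.zero _ _ _ _ hσ.1 hσ.2
      exact ⟨extend σ [],
        by simp [zeroRule, varList, extend, Term.eval, List.range_succ, numVars],
        by simp [zeroRule, row, Term.eval, extend, hT, hf, numVars, e]⟩
    · simp [hf] at hσ
      exact ⟨extend σ [],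
        by simp [zeroRule, varList, extend, Term.eval, List.range_succ, numVars, hσ],
        by simp [zeroRule, row, Term.eval, extend, hT, numVars, hσ]⟩
  · simp only [ChallengeRule.Matches, succRule, row, Term.eval,
      List.forall_mem_cons, List.map_cons,
      List.map_nil, hT] at hσ
    by_cases hf : σ 0 = 0
    · simp [hf] at hσ
      obtain ⟨k, e⟩ := hG.succ _ _ _ _ _ _ hσ.1 hσ.2.1 hσ.2.2
      exact ⟨extend σ [k],
        by simp [succRule, varList, extend, Term.eval, List.range_succ, numVars],
        by simp [succRule, row, Term.eval, extend, hT, hf, numVars, e]⟩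
    · simp [hf] at hσ
      exact ⟨extend σ [],
        by simp [succRule, varList, extend, Term.eval, List.range_succ, numVars, hσ],
        by simp [succRule, row, Term.eval, extend, hT, numVars, hσ]⟩
  · simp only [ChallengeRule.Matches, tailRule, row, Term.eval,
      List.forall_mem_cons, List.map_cons,
      List.map_nil, hT] at hσ
    by_cases hf : σ 0 = 0
    · simp [hf] at hσ
      have e := hG.tail _ _ _ _ _ _ hσ.1 hσ.2.1 hσ.2.2
      exact ⟨extend σ [],
        by simp [tailRule, varList, extend, Term.eval, List.range_succ, numVars, e],
        by simp [tailRule]⟩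
    · simp [hf] at hσ
      exact ⟨extend σ [],
        by simp [tailRule, varList, extend, Term.eval, List.range_succ, numVars, hσ],
        by simp [tailRule]⟩
  · simp only [ChallengeRule.Matches, consRule, row, Term.eval,
      List.forall_mem_cons, List.map_cons,
      List.map_nil, hT] at hσ
    by_cases hf : σ 0 = 0
    · simp [hf] at hσ
      obtain ⟨r, r', a, b, h, t, e⟩ := hG.cons _ _ _ _ _ _ hσ.1 hσ.2
      exact ⟨extend σ [r, r', a, b, h, t],
        by simp [consRule, varList, extend, Term.eval, List.range_succ, numVars],
        by simp [consRule, row, Term.eval, extend, hT, hf, numVars, e]⟩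
    · simp [hf] at hσ
      exact ⟨extend σ [],
        by simp [consRule, varList, extend, Term.eval, List.range_succ, numVars, hσ],
        by simp [consRule, row, Term.eval, extend, hT, numVars, hσ, tagLt]⟩
  · simp only [ChallengeRule.Matches, compRule, row, Term.eval,
      List.forall_mem_cons, List.map_cons,
      List.map_nil, hT] at hσ
    by_cases hf : σ 0 = 0
    · simp [hf] at hσ
      obtain ⟨r, r', a, e⟩ := hG.comp _ _ _ _ _ _ hσ.1 hσ.2
      exact ⟨extend σ [r, r', a],
        by simp [compRule, varList, extend, Term.eval, List.range_succ, numVars],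
        by simp [compRule, row, Term.eval, extend, hT, hf, numVars, e]⟩
    · simp [hf] at hσ
      exact ⟨extend σ [],
        by simp [compRule, varList, extend, Term.eval, List.range_succ, numVars, hσ],
        by simp [compRule, row, Term.eval, extend, hT, numVars, hσ, tagLt]⟩
  · simp only [ChallengeRule.Matches, caseZeroRule, row, Term.eval,
      List.forall_mem_cons, List.map_cons,
      List.map_nil, hT] at hσ
    by_cases hf : σ 0 = 0
    · simp [hf] at hσ
      obtain ⟨r, e⟩ := hG.case_zero _ _ _ _ _ _ _ hσ.1 hσ.2.1 hσ.2.2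
      exact ⟨extend σ [r],
        by simp [caseZeroRule, varList, extend, Term.eval, List.range_succ, numVars],
        by simp [caseZeroRule, row, Term.eval, extend, hT, hf, numVars, e]⟩
    · simp [hf] at hσ
      exact ⟨extend σ [],
        by simp [caseZeroRule, varList, extend, Term.eval, List.range_succ, numVars, hσ],
        by simp [caseZeroRule, row, Term.eval, extend, hT, numVars, hσ, tagLt]⟩
  · simp only [ChallengeRule.Matches, caseSuccRule, row, Term.eval,
      List.forall_mem_cons, List.map_cons,
      List.map_nil, hT] at hσ
    by_cases hf : σ 0 = 0
    · simp [hf] at hσ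
      obtain ⟨r, a, e⟩ := hG.case_succ _ _ _ _ _ _ _ _ _ hσ.1 hσ.2.1 hσ.2.2.1 hσ.2.2.2
      exact ⟨extend σ [r, a],
        by simp [caseSuccRule, varList, extend, Term.eval, List.range_succ, numVars],
        by simp [caseSuccRule, row, Term.eval, extend, hT, hf, numVars, e]⟩
    · simp [hf] at hσ
      exact ⟨extend σ [],
        by simp [caseSuccRule, varList, extend, Term.eval, List.range_succ, numVars, hσ],
        by simp [caseSuccRule, row, Term.eval, extend, hT, numVars, hσ, tagLt]⟩
  · simp only [ChallengeRule.Matches, headUniqueRule, row, Term.eval,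
      List.forall_mem_cons, List.map_cons,
      List.map_nil, hT] at hσ
    by_cases hf : σ 0 = 0
    · simp [hf] at hσ
      have e := hG.head_unique _ _ _ _ _ hσ.1 hσ.2
      exact ⟨extend σ [],
        by simp [headUniqueRule, varList, extend, Term.eval, List.range_succ, numVars, e],
        by simp [headUniqueRule]⟩
    · simp [hf] at hσ
      exact ⟨extend σ [],
        by simp [headUniqueRule, varList, extend, Term.eval, List.range_succ, numVars, hσ],
        by simp [headUniqueRule]⟩
  · simp only [ChallengeRule.Matches, ltTransRule, row, Term.eval,
      List.forall_mem_cons, List.map_cons,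
      List.map_nil, hT] at hσ
    by_cases hf : σ 0 = 0
    · simp [hf] at hσ
      have e := hG.lt_trans _ _ _ hσ.1 hσ.2
      exact ⟨extend σ [],
        by simp [ltTransRule, varList, extend, Term.eval, List.range_succ, numVars],
        by simp [ltTransRule, row, Term.eval, extend, hT, hf, numVars, e]⟩
    · simp [hf] at hσ
      exact ⟨extend σ [],
        by simp [ltTransRule, varList, extend, Term.eval, List.range_succ, numVars, hσ],
        by simp [ltTransRule, row, Term.eval, extend, hT, numVars, hσ, tagLt]⟩
  · simp only [ChallengeRule.Matches, ltIrreflRule, row, Term.eval,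
      List.forall_mem_cons, List.map_cons,
      List.map_nil, hT] at hσ
    by_cases hf : σ 0 = 0
    · simp [hf] at hσ
      exact absurd hσ (hG.lt_irrefl _)
    · simp [hf] at hσ
      exact ⟨extend σ [],
        by simp [ltIrreflRule, varList, extend, Term.eval, List.range_succ, numVars, hσ],
        by simp [ltIrreflRule]⟩

theorem exists_matches_of_flagged {T : Finset (List ℕ)} (hT : ∀ t < 10, [1, t, 0, 0, 0, 0] ∈ T) :
    ∀ ρ ∈ runRules, ∃ σ, ρ.Matches T σ := by
  have hT' : ∀ ρ ∈ runRules, ρ.Matches T fun i => if i = 0 then 1 else 0 := by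
    simp [runRules, zeroRule, succRule, tailRule, consRule, compRule, caseZeroRule, caseSuccRule,
      headUniqueRule, ltTransRule, ltIrreflRule, row, ChallengeRule.Matches, Term.eval, hT, tagRun,
      tagZeroI, tagSuccI, tagTailI, tagConsI, tagCompI, tagLt]
  exact fun ρ hρ => ⟨_, hT' ρ hρ⟩

end PQIProblem

/-! ### Programs as finite call graphs. -/

namespace PQIProblem

open Turing.ToPartrec

/-- Instructions on lists of naturals, calling the programs labelled by the elements of `N`. -/
inductive Instr (N : Type) where
  | zero
  | succ
  | tail
  | cons (f g : N)
  | comp (f g : N)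
  | case (f g : N)

namespace Instr

variable {N : Type}

def tag : Instr N → ℕ
  | zero => tagZeroI
  | succ => tagSuccI
  | tail => tagTailI
  | cons _ _ => tagConsI
  | comp _ _ => tagCompI
  | case _ _ => tagCaseI

def left (num : N → ℕ) : Instr N → ℕ
  | cons f _ | comp f _ | case f _ => num f
  | _ => 0

def right (num : N → ℕ) : Instr N → ℕ
  | cons _ g | comp _ g | case _ g => num g
  | _ => 0

/-- All labels called by the instruction satisfy `p`. -/
def All (p : N → Prop) : Instr N → Prop
  | cons f g | comp f g | case f g => p f ∧ p g
  | _ => True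

theorem All.imp {p q : N → Prop} (h : ∀ n, p n → q n) {i : Instr N} : i.All p → i.All q := by
  cases i <;> simp only [All, imp_self]
  all_goals exact fun hp => ⟨h _ hp.1, h _ hp.2⟩

/-- The partial function computed by an instruction, if label `f` computes `S f`. -/
def step (S : N → List ℕ →. List ℕ) : Instr N → List ℕ →. List ℕ
  | zero => fun v => Part.some (0 :: v)
  | succ => fun v => Part.some [v.headI.succ]
  | tail => fun v => Part.some v.tail
  | cons f g => fun v => (S f v).bind fun n => (S g v).bind fun ns => Part.some (n.headI :: ns)
  | comp f g => fun v => (S g v).bind fun u => S f u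
  | case f g => fun v => v.headI.rec (S f v.tail) fun y _ => S g (y :: v.tail)

end Instr

/-- The labels of a program without loops as a primitive: `fix f` becomes a cyclic call graph. -/
inductive Node where
  | of (c : Code)
  | loop (f : Code)
  | again (f : Code)
  deriving DecidableEq

namespace Node

/-- The code `fix f` runs `f` and passes the result to `loop f`, which exits with the tail if the
head is `0`. Otherwise `case` puts the predecessor of the head back in front, and `again f` drops it
before restarting. -/
def instr : Node → Instr Node
  | of Code.zero' => .zero
  | of Code.succ => .succ
  | of Code.tail => .tail
  | of (Code.cons f g) => .cons (of f) (of g)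
  | of (Code.comp f g) => .comp (of f) (of g)
  | of (Code.case f g) => .case (of f) (of g)
  | of (Code.fix f) => .comp (loop f) (of f)
  | loop f => .case (of Code.id) (again f)
  | again f => .comp (of (Code.fix f)) (of Code.tail)

def sem : Node → List ℕ →. List ℕ
  | of c => c.eval
  | loop f => fun u => if u.headI = 0 then Part.some u.tail else (Code.fix f).eval u.tail
  | again f => fun u => (Code.fix f).eval u.tail

/-- The semantics is a fixed point of the call graph. Only `fix` needs an argument: one unfolding of
`PFun.fix`. -/
theorem sem_eq_step (k : Node) : k.sem = k.instr.step sem := by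
  funext v
  match k with
  | of Code.zero' | of Code.succ | of Code.tail | of (Code.cons f g)
  | of (Code.case f g) => simp [sem, instr, Instr.step]
  | of (Code.comp f g) =>
    simp only [sem, instr, Instr.step, Code.comp_eval]
    rfl
  | of (Code.fix f) =>
    refine Part.ext fun w => ?_
    simp only [sem, instr, Instr.step, Code.fix_eval, Part.mem_bind_iff]
    refine PFun.mem_fix_iff.trans ?_
    simp only [Part.mem_map_iff]
    constructor
    · rintro (⟨a, ha, h⟩ | ⟨a', ⟨a, ha, h⟩, h'⟩)
      · refine ⟨a, ha, ?_⟩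
        split_ifs at h ⊢ with h0
        cases h
        simp
      · refine ⟨a, ha, ?_⟩
        split_ifs at h ⊢ with h0
        cases h
        exact h'
    · rintro ⟨a, ha, h⟩
      split_ifs at h with h0
      · refine Or.inl ⟨a, ha, ?_⟩
        simp [h0, Part.mem_some_iff.1 h]
      · exact Or.inr ⟨a.tail, ⟨a, ha, by simp [h0]⟩, h⟩
  | loop f =>
    simp only [sem, instr, Instr.step, Code.id_eval]
    rcases v.headI with _ | n <;> simp
  | again f =>
    simp only [sem, instr, Instr.step, Code.tail_eval]
    exact (Part.bind_some _ _).symm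

/-- The labels reachable from `of c`. -/
def reach : Code → List Node
  | Code.zero' => [of Code.zero']
  | Code.succ => [of Code.succ]
  | Code.tail => [of Code.tail]
  | Code.cons f g => of (Code.cons f g) :: (reach f ++ reach g)
  | Code.comp f g => of (Code.comp f g) :: (reach f ++ reach g)
  | Code.case f g => of (Code.case f g) :: (reach f ++ reach g)
  | Code.fix f =>
    -- `Code.id` is the composition of `tail` with `zero'`, hence the last two labels.
    [of (Code.fix f), loop f, again f, of Code.id, of Code.tail, of Code.zero'] ++ reach f

theorem of_mem_reach (c : Code) : of c ∈ reach c := by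
  cases c <;> simp [reach]

theorem reach_closed (c : Code) : ∀ k ∈ reach c, k.instr.All (· ∈ reach c) := by
  induction c with
  | zero' | succ | tail => simp [reach, instr, Instr.All]
  | cons f g hf hg | comp f g hf hg | case f g hf hg =>
    intro k hk
    rcases List.mem_cons.1 hk with rfl | hk
    · simp [reach, instr, Instr.All, of_mem_reach]
    rcases List.mem_append.1 hk with hk | hk
    · exact (hf k hk).imp fun n hn => by simp [reach, hn]
    · exact (hg k hk).imp fun n hn => by simp [reach, hn]
  | fix f hf =>
    intro k hk
    rcases List.mem_append.1 hk with hk | hk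
    · simp only [List.mem_cons, List.not_mem_nil, or_false] at hk
      rcases hk with rfl | rfl | rfl | rfl | rfl | rfl <;>
        simp [reach, instr, Instr.All, of_mem_reach, Code.id]
    · exact (hf k hk).imp fun n hn => by simp [reach, hn]

end Node

/-! ### Recorded runs are genuine computations. -/

section Soundness

variable {G : ℕ → ℕ → ℕ → ℕ → ℕ → Prop}

/-- `x` represents the natural number. -/
def RepNat (G : ℕ → ℕ → ℕ → ℕ → ℕ → Prop) : ℕ → ℕ → Prop
  | 0, x => x = 0
  | n + 1, x => ∃ y, G tagSucc y x 0 0 ∧ RepNat G n y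

/-- `x` represents the list of natural numbers. -/
def RepList (G : ℕ → ℕ → ℕ → ℕ → ℕ → Prop) : List ℕ → ℕ → Prop
  | [], x => x = 0
  | n :: l, x => ∃ h t, G tagPair h t x 0 ∧ RepNat G n h ∧ RepList G l t

/-- The row `h0` splits the empty list into head `0` and empty tail, matching the conventions of
`headI` and `tail`. -/
theorem RepList.exists_pair (h0 : G tagPair 0 0 0 0) {l : List ℕ} {x : ℕ} (h : RepList G l x) :
    ∃ a t, G tagPair a t x 0 ∧ RepNat G l.headI a ∧ RepList G l.tail t := by
  cases l with
  | nil => cases h; exact ⟨0, 0, h0, rfl, rfl⟩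
  | cons n l => exact h

/-- Well-founded induction on the rank. Representations need not be unique and extra rows are
harmless, since each rule applies to all recorded instructions and decompositions. -/
theorem sound_of_isRunModel (hG : IsRunModel G) (h0 : G tagPair 0 0 0 0)
    (hlt : WellFounded fun a b => G tagLt a b 0 0) {K : Node → Prop} {num : Node → ℕ}
    (hK : ∀ k, K k → k.instr.All K)
    (hnum : ∀ k, K k → G k.instr.tag (num k) (k.instr.left num) (k.instr.right num) 0)
    (r : ℕ) : ∀ (k : Node) (v : List ℕ) (x y : ℕ), K k → RepList G v x → G tagRun r (num k) x y →
      ∃ w ∈ k.sem v, RepList G w y := by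
  induction r using hlt.induction with
  | _ r ih =>
  intro k v x y hk hv hrun
  have hc := hK k hk
  have hi := hnum k hk
  rw [Node.sem_eq_step]
  obtain ⟨a, t, hat, ha, ht⟩ := hv.exists_pair h0
  generalize k.instr = i at hc hi
  cases i with
  | zero => exact ⟨0 :: v, by simp [Instr.step], 0, x, hG.zero _ _ _ _ hrun hi, rfl, hv⟩
  | succ =>
    obtain ⟨b, hb, hby⟩ := hG.succ _ _ _ _ _ _ hrun hi hat
    exact ⟨[v.headI.succ], by simp [Instr.step], b, 0, hby, ⟨a, hb, ha⟩, rfl⟩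
  | tail => exact ⟨v.tail, by simp [Instr.step], hG.tail _ _ _ _ _ _ hrun hi hat ▸ ht⟩
  | cons f g =>
    obtain ⟨r₁, r₂, x₁, x₂, h, t', hr₁, hr₂, hf, hg, h1, h2⟩ := hG.cons _ _ _ _ _ _ hrun hi
    obtain ⟨w₁, hw₁, hx₁⟩ := ih r₁ hr₁ f v x x₁ hc.1 hv hf
    obtain ⟨w₂, hw₂, hx₂⟩ := ih r₂ hr₂ g v x x₂ hc.2 hv hg
    obtain ⟨a', t'', h3, h4, -⟩ := hx₁.exists_pair h0
    refine ⟨w₁.headI :: w₂, ?_, h, x₂, h2, ?_, hx₂⟩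
    · exact Part.mem_bind hw₁ (Part.mem_bind hw₂ (Part.mem_some _))
    -- The rule for `cons` uses some decomposition of the first result, possibly not the one
    -- representing `w₁`; their heads agree.
    · rwa [hG.head_unique _ _ _ _ _ h1 h3]
  | comp f g =>
    obtain ⟨r₁, r₂, u, hr₁, hr₂, hg, hf⟩ := hG.comp _ _ _ _ _ _ hrun hi
    obtain ⟨w₁, hw₁, hx₁⟩ := ih r₁ hr₁ g v x u hc.2 hv hg
    obtain ⟨w₂, hw₂, hx₂⟩ := ih r₂ hr₂ f w₁ u y hc.1 hx₁ hf
    exact ⟨w₂, Part.mem_bind hw₁ hw₂, hx₂⟩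
  | case f g =>
    simp only [Instr.step]
    generalize v.headI = n at ha
    rcases n with _ | n
    · cases ha
      obtain ⟨r₁, hr₁, hf⟩ := hG.case_zero _ _ _ _ _ _ _ hrun hi hat
      exact ih r₁ hr₁ f v.tail t y hc.1 ht hf
    · obtain ⟨b, hb, hn⟩ := ha
      obtain ⟨r₁, u, hu, hr₁, hg⟩ := hG.case_succ _ _ _ _ _ _ _ _ _ hrun hi hat hb
      exact ih r₁ hr₁ g (n :: v.tail) u y hc.2 ⟨b, t, hu, hn, ht⟩ hg

/-- The number of predecessors strictly increases along the order, by transitivity and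
irreflexivity. -/
theorem wellFounded_lt_of_isRunModel (hG : IsRunModel G) {s : Finset ℕ}
    (hs : ∀ a b, G tagLt a b 0 0 → a ∈ s) : WellFounded fun a b => G tagLt a b 0 0 := by
  classical
  refine Subrelation.wf (r := InvImage (· < ·) fun b => (s.filter fun a => G tagLt a b 0 0).card) ?_
    (InvImage.wf _ Nat.lt_wfRel.wf)
  intro a b hab
  refine Finset.card_lt_card (Finset.ssubset_iff_of_subset ?_ |>.2 ⟨a, ?_, ?_⟩)
  · intro c hc
    rw [Finset.mem_filter] at hc ⊢
    exact ⟨hc.1, hG.lt_trans _ _ _ hc.2 hab⟩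
  · exact Finset.mem_filter.2 ⟨hs _ _ hab, hab⟩
  · exact fun h => hG.lt_irrefl a (Finset.mem_filter.1 h).2

theorem repNat_self {n : ℕ} (h : ∀ i < n, G tagSucc i (i + 1) 0 0) : RepNat G n n := by
  induction n with
  | zero => rfl
  | succ n ih => exact ⟨n, h n n.lt_succ_self, ih fun i hi => h i (hi.trans n.lt_succ_self)⟩

end Soundness

end PQIProblem

/-! ### Completeness: finite ranked derivations and their certificates. -/

namespace PQIProblem

open Turing.ToPartrec Encodable

/-- The computation `v ↦ w` of the instruction, with rank `r`, follows from computations in `X` of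
smaller rank. -/
def Instr.Justified (X : Finset (ℕ × Node × List ℕ × List ℕ)) (r : ℕ) (v w : List ℕ) :
    Instr Node → Prop
  | zero => w = 0 :: v
  | succ => w = [v.headI.succ]
  | tail => w = v.tail
  | cons f g => ∃ r₁ r₂ a b, r₁ < r ∧ r₂ < r ∧ (r₁, f, v, a) ∈ X ∧ (r₂, g, v, b) ∈ X ∧
      w = a.headI :: b
  | comp f g => ∃ r₁ r₂ a, r₁ < r ∧ r₂ < r ∧ (r₁, g, v, a) ∈ X ∧ (r₂, f, a, w) ∈ X
  | case f g => ∃ r₁ < r, (v.headI = 0 → (r₁, f, v.tail, w) ∈ X) ∧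
      ∀ y, v.headI = y + 1 → (r₁, g, y :: v.tail, w) ∈ X

theorem Instr.Justified.mono {X Y : Finset (ℕ × Node × List ℕ × List ℕ)} (h : X ⊆ Y) {r : ℕ}
    {v w : List ℕ} {i : Instr Node} (hi : i.Justified X r v w) : i.Justified Y r v w := by
  cases i with
  | zero | succ | tail => exact hi
  | cons f g =>
    obtain ⟨r₁, r₂, a, b, h1, h2, h3, h4, h5⟩ := hi
    exact ⟨r₁, r₂, a, b, h1, h2, h h3, h h4, h5⟩
  | comp f g =>
    obtain ⟨r₁, r₂, a, h1, h2, h3, h4⟩ := hi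
    exact ⟨r₁, r₂, a, h1, h2, h h3, h h4⟩
  | case f g =>
    obtain ⟨r₁, h1, h2, h3⟩ := hi
    exact ⟨r₁, h1, fun h0 => h (h2 h0), fun y hy => h (h3 y hy)⟩

def IsClosed (X : Finset (ℕ × Node × List ℕ × List ℕ)) : Prop :=
  ∀ r k v w, (r, k, v, w) ∈ X → k.instr.Justified X r v w

/-- Coinciding ranks cause no conflict, because justification only asks for the existence of smaller
entries. -/
theorem IsClosed.union {X Y : Finset (ℕ × Node × List ℕ × List ℕ)} (hX : IsClosed X)
    (hY : IsClosed Y) : IsClosed (X ∪ Y) := by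
  intro r k v w h
  rcases Finset.mem_union.1 h with h | h
  · exact (hX _ _ _ _ h).mono Finset.subset_union_left
  · exact (hY _ _ _ _ h).mono Finset.subset_union_right

/-- Some finite set of computations justifies that label `k` maps `v` to `w`. -/
def Derivable (k : Node) (v w : List ℕ) : Prop :=
  ∃ X, IsClosed X ∧ ∃ r, (r, k, v, w) ∈ X

section Derivable

variable {k f g : Node} {u v w : List ℕ}

theorem Derivable.of_justified {X : Finset (ℕ × Node × List ℕ × List ℕ)} (hX : IsClosed X) {r : ℕ}
    (h : k.instr.Justified X r v w) : Derivable k v w := by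
  refine ⟨insert (r, k, v, w) X, fun r' k' v' w' h' => ?_, r, Finset.mem_insert_self _ _⟩
  refine Instr.Justified.mono (Finset.subset_insert _ _) ?_
  rcases Finset.mem_insert.1 h' with h' | h'
  · cases h'; exact h
  · exact hX _ _ _ _ h'

theorem isClosed_empty : IsClosed ∅ := fun _ _ _ _ h => absurd h (Finset.notMem_empty _)

theorem Derivable.cons (hk : k.instr = .cons f g) (hf : Derivable f v u) (hg : Derivable g v w) :
    Derivable k v (u.headI :: w) := by
  obtain ⟨X, hX, r₁, h₁⟩ := hf
  obtain ⟨Y, hY, r₂, h₂⟩ := hg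
  refine Derivable.of_justified (hX.union hY) (r := r₁ + r₂ + 1) ?_
  rw [hk]
  exact ⟨r₁, r₂, u, w, by omega, by omega, Finset.mem_union_left _ h₁,
    Finset.mem_union_right _ h₂, rfl⟩

theorem Derivable.comp (hk : k.instr = .comp f g) (hg : Derivable g v u) (hf : Derivable f u w) :
    Derivable k v w := by
  obtain ⟨X, hX, r₁, h₁⟩ := hg
  obtain ⟨Y, hY, r₂, h₂⟩ := hf
  refine Derivable.of_justified (hX.union hY) (r := r₁ + r₂ + 1) ?_
  rw [hk]
  exact ⟨r₁, r₂, u, by omega, by omega, Finset.mem_union_left _ h₁, Finset.mem_union_right _ h₂⟩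

theorem Derivable.case_zero (hk : k.instr = .case f g) (hv : v.headI = 0)
    (hf : Derivable f v.tail w) : Derivable k v w := by
  obtain ⟨X, hX, r, h⟩ := hf
  refine Derivable.of_justified hX (r := r + 1) ?_
  rw [hk]
  exact ⟨r, by omega, fun _ => h, fun y hy => by omega⟩

theorem Derivable.case_succ (hk : k.instr = .case f g) {y : ℕ} (hv : v.headI = y + 1)
    (hg : Derivable g (y :: v.tail) w) : Derivable k v w := by
  obtain ⟨X, hX, r, h⟩ := hg
  refine Derivable.of_justified hX (r := r + 1) ?_
  rw [hk]
  refine ⟨r, by omega, fun h0 => by omega, fun z hz => ?_⟩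
  obtain rfl : z = y := by omega
  exact h

theorem derivable_zero (v : List ℕ) : Derivable (.of .zero') v (0 :: v) :=
  .of_justified isClosed_empty (r := 0) rfl

theorem derivable_tail (v : List ℕ) : Derivable (.of .tail) v v.tail :=
  .of_justified isClosed_empty (r := 0) rfl

theorem derivable_id (v : List ℕ) : Derivable (.of .id) v v :=
  .comp (f := .of .tail) (g := .of .zero') rfl (derivable_zero v) (derivable_tail _)

/-- Induction on the code, with an inner induction on the iterations of `fix`. -/
theorem derivable_of_mem_eval (c : Code) : ∀ v w, w ∈ c.eval v → Derivable (.of c) v w := by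
  induction c with
  | zero' =>
    intro v w h
    simp only [Code.zero'_eval] at h
    rw [Part.mem_some_iff.1 h]
    exact derivable_zero v
  | succ =>
    intro v w h
    simp only [Code.succ_eval] at h
    rw [Part.mem_some_iff.1 h]
    exact .of_justified isClosed_empty (r := 0) rfl
  | tail =>
    intro v w h
    simp only [Code.tail_eval] at h
    rw [Part.mem_some_iff.1 h]
    exact derivable_tail v
  | cons f g hf hg =>
    intro v w h
    change w ∈ (Node.of (.cons f g)).sem v at h
    rw [Node.sem_eq_step] at h
    obtain ⟨a, ha, h⟩ := Part.mem_bind_iff.1 h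
    obtain ⟨b, hb, h⟩ := Part.mem_bind_iff.1 h
    rw [Part.mem_some_iff.1 h]
    exact .cons rfl (hf _ _ ha) (hg _ _ hb)
  | comp f g hf hg =>
    intro v w h
    change w ∈ (Node.of (.comp f g)).sem v at h
    rw [Node.sem_eq_step] at h
    obtain ⟨a, ha, h⟩ := Part.mem_bind_iff.1 h
    exact .comp rfl (hg _ _ ha) (hf _ _ h)
  | case f g hf hg =>
    intro v w h
    change w ∈ (Node.of (.case f g)).sem v at h
    rw [Node.sem_eq_step] at h
    simp only [Node.instr, Instr.step] at h
    rcases hn : v.headI with _ | n <;> rw [hn] at h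
    · exact .case_zero rfl hn (hf _ _ h)
    · exact .case_succ rfl hn (hg _ _ h)
  | fix f hf =>
    intro v w h
    simp only [Code.fix_eval] at h
    refine PFun.fixInduction h fun v h ih => ?_
    have h' : w ∈ (Node.of (.fix f)).sem v := by
      simp only [Node.sem, Code.fix_eval]
      exact h
    rw [Node.sem_eq_step] at h'
    obtain ⟨a, ha, h'⟩ := Part.mem_bind_iff.1 h'
    refine .comp (u := a) rfl (hf _ _ ha) ?_
    simp only [Node.sem] at h'
    rcases hn : a.headI with _ | n
    · rw [if_pos hn] at h'
      rw [Part.mem_some_iff.1 h']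
      exact .case_zero rfl hn (derivable_id _)
    · refine .case_succ rfl hn (.comp rfl (derivable_tail _) (ih _ ?_))
      exact (Part.mem_map_iff _).2 ⟨a, ha, by simp [hn]⟩

end Derivable

/-- With `encode_tail_le`, this keeps the decomposition of a list below any bound on its code, so
truncation at `B` loses no needed row. -/
theorem headI_le_encode (l : List ℕ) : l.headI ≤ encode l := by
  cases l with
  | nil => simp
  | cons a l =>
    rw [encode_list_cons, List.headI_cons]
    exact (Nat.left_le_pair _ _).trans (Nat.le_succ _)

theorem encode_tail_le (l : List ℕ) : encode l.tail ≤ encode l := by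
  cases l with
  | nil => simp
  | cons a l =>
    rw [encode_list_cons, List.tail_cons]
    exact (Nat.right_le_pair _ _).trans (Nat.le_succ _)

section Certificate

variable {X : Finset (ℕ × Node × List ℕ × List ℕ)} {K : List Node} {B : ℕ}

/-- The true rows about the computations in `X` and the program labels in `K`; labels are numbered
by their position in `K`. -/
def CertRow (X : Finset (ℕ × Node × List ℕ × List ℕ)) (K : List Node) :
    ℕ → ℕ → ℕ → ℕ → ℕ → Prop
  | 0, a, b, c, d => b = a + 1 ∧ c = 0 ∧ d = 0
  | 1, a, b, c, d => ∃ l : List ℕ, a = l.headI ∧ b = encode l.tail ∧ c = encode l ∧ d = 0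
  | 2, a, b, c, d => ∃ k ∈ K, ∃ v w, (a, k, v, w) ∈ X ∧ b = K.idxOf k ∧ c = encode v ∧ d = encode w
  | 3, a, b, c, d => a < b ∧ c = 0 ∧ d = 0
  | t, a, b, c, d => ∃ k ∈ K, t = k.instr.tag ∧ a = K.idxOf k ∧ b = k.instr.left K.idxOf ∧
      c = k.instr.right K.idxOf ∧ d = 0

/-- The rows of `CertRow` with arguments at most `B`. -/
def CertRel (X : Finset (ℕ × Node × List ℕ × List ℕ)) (K : List Node) (B : ℕ)
    (t a b c d : ℕ) : Prop :=
  a ≤ B ∧ b ≤ B ∧ c ≤ B ∧ d ≤ B ∧ CertRow X K t a b c d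

theorem Instr.tag_lt {N : Type} (i : Instr N) : i.tag < 10 := by
  cases i <;> exact of_decide_eq_true rfl

theorem certRow_instr {k : Node} (hk : k ∈ K) :
    CertRow X K k.instr.tag (K.idxOf k) (k.instr.left K.idxOf) (k.instr.right K.idxOf) 0 := by
  rcases hi : k.instr <;> exact ⟨k, hk, by rw [hi], rfl, by rw [hi], by rw [hi], rfl⟩

/-- Each run rule reads off the justification of the corresponding entry of `X`; the bounds keep all
witnesses within the truncation. -/
theorem isRunModel_certRel (hX : IsClosed X) (hK : ∀ k ∈ K, k.instr.All (· ∈ K))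
    (hXB : ∀ r k v w, (r, k, v, w) ∈ X → r ≤ B ∧ encode v ≤ B ∧ encode w ≤ B)
    (hKB : K.length ≤ B) : IsRunModel (CertRel X K B) := by
  have hidx : ∀ k, K.idxOf k ≤ B := fun k => List.idxOf_le_length.trans hKB
  have run_inv : ∀ {r c x y : ℕ}, CertRel X K B tagRun r c x y → ∃ k ∈ K, ∃ v w,
      (r, k, v, w) ∈ X ∧ c = K.idxOf k ∧ x = encode v ∧ y = encode w := fun h => h.2.2.2.2
  have pair_inv : ∀ {h t : ℕ} {v : List ℕ}, CertRel X K B tagPair h t (encode v) 0 →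
      h = v.headI ∧ t = encode v.tail := by
    rintro h t v ⟨-, -, -, -, l, h1, h2, h3, -⟩
    rw [encode_injective h3]
    exact ⟨h1, h2⟩
  have pair_mk : ∀ {l : List ℕ}, encode l ≤ B →
      CertRel X K B tagPair l.headI (encode l.tail) (encode l) 0 := fun {l} h =>
    ⟨(headI_le_encode l).trans h, (encode_tail_le l).trans h, h, Nat.zero_le _, l, rfl, rfl, rfl,
      rfl⟩
  have run_mk : ∀ {r k v w}, (r, k, v, w) ∈ X → k ∈ K →
      CertRel X K B tagRun r (K.idxOf k) (encode v) (encode w) := fun {r k v w} h hk =>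
    ⟨(hXB _ _ _ _ h).1, hidx _, (hXB _ _ _ _ h).2.1, (hXB _ _ _ _ h).2.2, k, hk, v, w, h, rfl,
      rfl, rfl⟩
  have lt_mk : ∀ {a b : ℕ}, a < b → b ≤ B → CertRel X K B tagLt a b 0 0 := fun h hb =>
    ⟨h.le.trans hb, hb, Nat.zero_le _, Nat.zero_le _, h, rfl, rfl⟩
  have instr_inv : ∀ {t : ℕ} {k : Node} {b c : ℕ}, 4 ≤ t → k ∈ K →
      CertRel X K B t (K.idxOf k) b c 0 →
      t = k.instr.tag ∧ b = k.instr.left K.idxOf ∧ c = k.instr.right K.idxOf := by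
    rintro t k b c ht hk ⟨-, -, -, -, h⟩
    obtain ⟨t, rfl⟩ := Nat.exists_eq_add_of_le' ht
    obtain ⟨k', hk', h1, h2, h3, h4, -⟩ := h
    -- Positions determine the members of `K`, so a label carries only its own instruction.
    obtain rfl : k = k' := (List.idxOf_inj hk).1 h2
    exact ⟨h1, h3, h4⟩
  constructor
  · intro r c x y h1 h2
    obtain ⟨k, hk, v, w, hm, rfl, rfl, rfl⟩ := run_inv h1
    obtain ⟨e, -, -⟩ := instr_inv (by decide) hk h2
    have hj := hX _ _ _ _ hm
    rcases hi : k.instr <;> rw [hi] at hj e <;> try cases e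
    cases hj
    exact pair_mk (hXB _ _ _ _ hm).2.2
  · intro r c x y h t h1 h2 h3
    obtain ⟨k, hk, v, w, hm, rfl, rfl, rfl⟩ := run_inv h1
    obtain ⟨e, -, -⟩ := instr_inv (by decide) hk h2
    obtain ⟨rfl, rfl⟩ := pair_inv h3
    have hj := hX _ _ _ _ hm
    rcases hi : k.instr <;> rw [hi] at hj e <;> try cases e
    cases hj
    have hp := pair_mk (hXB _ _ _ _ hm).2.2
    -- The successor is at most `B` because it is the head of the output list, whose code is.
    exact ⟨v.headI.succ, ⟨h3.1, hp.1, Nat.zero_le _, Nat.zero_le _, rfl, rfl, rfl⟩, hp⟩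
  · intro r c x y h t h1 h2 h3
    obtain ⟨k, hk, v, w, hm, rfl, rfl, rfl⟩ := run_inv h1
    obtain ⟨e, -, -⟩ := instr_inv (by decide) hk h2
    obtain ⟨rfl, rfl⟩ := pair_inv h3
    have hj := hX _ _ _ _ hm
    rcases hi : k.instr <;> rw [hi] at hj e <;> try cases e
    cases hj
    rfl
  · intro r c x y f' g' h1 h2
    obtain ⟨k, hk, v, w, hm, rfl, rfl, rfl⟩ := run_inv h1
    obtain ⟨e, e1, e2⟩ := instr_inv (by decide) hk h2
    have hj := hX _ _ _ _ hm
    have hc := hK k hk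
    rcases hi : k.instr with _ | _ | _ | ⟨f, g⟩ | _ | _ <;> rw [hi] at hj e e1 e2 hc <;>
      try cases e
    obtain ⟨r₁, r₂, a, b, hr₁, hr₂, hf, hg, rfl⟩ := hj
    have hr := (hXB _ _ _ _ hm).1
    subst e1 e2
    exact ⟨r₁, r₂, encode a, encode b, a.headI, encode a.tail, lt_mk hr₁ hr, lt_mk hr₂ hr,
      run_mk hf hc.1, run_mk hg hc.2, pair_mk (hXB _ _ _ _ hf).2.2,
      pair_mk (hXB _ _ _ _ hm).2.2⟩
  · intro r c x y f' g' h1 h2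
    obtain ⟨k, hk, v, w, hm, rfl, rfl, rfl⟩ := run_inv h1
    obtain ⟨e, e1, e2⟩ := instr_inv (by decide) hk h2
    have hj := hX _ _ _ _ hm
    have hc := hK k hk
    rcases hi : k.instr with _ | _ | _ | _ | ⟨f, g⟩ | _ <;> rw [hi] at hj e e1 e2 hc <;>
      try cases e
    obtain ⟨r₁, r₂, a, hr₁, hr₂, hg, hf⟩ := hj
    have hr := (hXB _ _ _ _ hm).1
    subst e1 e2
    exact ⟨r₁, r₂, encode a, lt_mk hr₁ hr, lt_mk hr₂ hr, run_mk hg hc.2, run_mk hf hc.1⟩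
  · intro r c x y f' g' t h1 h2 h3
    obtain ⟨k, hk, v, w, hm, rfl, rfl, rfl⟩ := run_inv h1
    obtain ⟨e, e1, e2⟩ := instr_inv (by decide) hk h2
    obtain ⟨hv, rfl⟩ := pair_inv h3
    have hj := hX _ _ _ _ hm
    have hc := hK k hk
    rcases hi : k.instr with _ | _ | _ | _ | _ | ⟨f, g⟩ <;> rw [hi] at hj e e1 e2 hc <;>
      try cases e
    obtain ⟨r₁, hr₁, hf, -⟩ := hj
    subst e1 e2
    exact ⟨r₁, lt_mk hr₁ (hXB _ _ _ _ hm).1, run_mk (hf hv.symm) hc.1⟩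
  · intro r c x y f' g' h t z h1 h2 h3 h4
    obtain ⟨k, hk, v, w, hm, rfl, rfl, rfl⟩ := run_inv h1
    obtain ⟨e, e1, e2⟩ := instr_inv (by decide) hk h2
    obtain ⟨rfl, rfl⟩ := pair_inv h3
    have hj := hX _ _ _ _ hm
    have hc := hK k hk
    rcases hi : k.instr with _ | _ | _ | _ | _ | ⟨f, g⟩ <;> rw [hi] at hj e e1 e2 hc <;>
      try cases e
    obtain ⟨r₁, hr₁, -, hg⟩ := hj
    subst e1 e2
    have hg' := hg z h4.2.2.2.2.1
    exact ⟨r₁, encode (z :: v.tail), pair_mk (hXB _ _ _ _ hg').2.1,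
      lt_mk hr₁ (hXB _ _ _ _ hm).1, run_mk hg' hc.2⟩
  · rintro h t h' t' x ⟨-, -, -, -, l, rfl, -, rfl, -⟩ h2
    exact (pair_inv h2).1.symm
  · rintro a b c ⟨-, -, -, -, h1, -⟩ ⟨-, hc, -, -, h2, -⟩
    exact lt_mk (h1.trans h2) hc
  · rintro a ⟨-, -, -, -, h, -⟩
    exact lt_irrefl a h

end Certificate

/-- A finite set of rows containing those of `G` with flag `0`, and the all-zero rows with
flag `1`. -/
theorem exists_finset_rows {G : ℕ → ℕ → ℕ → ℕ → ℕ → Prop} {B : ℕ}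
    (hG : ∀ t a b c d, G t a b c d → t < 10 ∧ a ≤ B ∧ b ≤ B ∧ c ≤ B ∧ d ≤ B) :
    ∃ T : Finset (List ℕ), (∀ l ∈ T, l.length = 6) ∧ ∀ f t a b c d, [f, t, a, b, c, d] ∈ T ↔
      (f = 0 ∧ G t a b c d) ∨ (f = 1 ∧ t < 10 ∧ a = 0 ∧ b = 0 ∧ c = 0 ∧ d = 0) := by
  classical
  let R := Finset.range (B + 1)
  refine ⟨((Finset.range 2 ×ˢ Finset.range 10 ×ˢ R ×ˢ R ×ˢ R ×ˢ R).filter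
    fun p => (p.1 = 0 ∧ G p.2.1 p.2.2.1 p.2.2.2.1 p.2.2.2.2.1 p.2.2.2.2.2) ∨
      (p.1 = 1 ∧ p.2.1 < 10 ∧ p.2.2.1 = 0 ∧ p.2.2.2.1 = 0 ∧ p.2.2.2.2.1 = 0 ∧
        p.2.2.2.2.2 = 0)).image
      fun p => [p.1, p.2.1, p.2.2.1, p.2.2.2.1, p.2.2.2.2.1, p.2.2.2.2.2], ?_, ?_⟩
  · intro l hl
    obtain ⟨p, -, rfl⟩ := Finset.mem_image.1 hl
    rfl
  · intro f t a b c d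
    rw [Finset.mem_image]
    constructor
    · rintro ⟨⟨f', t', a', b', c', d'⟩, hp, he⟩
      simp only [List.cons.injEq, and_true] at he
      obtain ⟨rfl, rfl, rfl, rfl, rfl, rfl⟩ := he
      exact (Finset.mem_filter.1 hp).2
    · intro h
      refine ⟨(f, t, a, b, c, d), Finset.mem_filter.2 ⟨?_, h⟩, rfl⟩
      simp only [R, Finset.mem_product, Finset.mem_range]
      rcases h with ⟨rfl, h⟩ | ⟨rfl, ht, rfl, rfl, rfl, rfl⟩
      · have := hG _ _ _ _ _ h
        omega
      · omega

/-! ### The reduction from halting. -/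

/-- A row of constants with flag `0`. -/
def groundRow (t a b c d : ℕ) : List Term :=
  [Sum.inr 0, Sum.inr t, Sum.inr a, Sum.inr b, Sum.inr c, Sum.inr d]

/-- The demanded rows that do not depend on the input: the program and the pairing of `0`. -/
def programDemands (c : Code) : List (List Term) :=
  groundRow tagPair 0 0 0 0 :: (Node.reach c).map fun k =>
    groundRow k.instr.tag ((Node.reach c).idxOf k) (k.instr.left (Node.reach c).idxOf)
      (k.instr.right (Node.reach c).idxOf) 0

/-- The demanded rows for the input `[n]`: a run on this input, and a representation of it. -/
def inputDemands (c : Code) (n : ℕ) : List (List Term) :=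
  [Sum.inr 0, Sum.inr tagRun, Sum.inl 0, Sum.inr ((Node.reach c).idxOf (.of c)),
    Sum.inr (encode [n]), Sum.inl 1] :: groundRow tagPair n 0 (encode [n]) 0 ::
      (List.range n).map fun i => groundRow tagSucc i (i + 1) 0 0

theorem demands_length (c : Code) (n : ℕ) :
    ∀ a ∈ programDemands c ++ inputDemands c n, a.length = 6 := by
  simp only [programDemands, inputDemands, groundRow, List.mem_append, List.mem_cons,
    List.mem_map]
  rintro a ((rfl | ⟨_, -, rfl⟩) | (rfl | rfl | ⟨_, -, rfl⟩)) <;> rfl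

/-- The constraints stating the existence of a correct run of `c` on input `[n]`. -/
def haltConstraints (c : Code) (n : ℕ) : List LinearTGD :=
  challengeConstraints numVars runRules ++
    demandConstraints (programDemands c ++ inputDemands c n)

def runSchema : Schema := challengeSchema 6 numVars runRules.length

theorem existsPQI_haltConstraints_iff (c : Code) (n : ℕ) :
    ExistsPQI (challengeQuery runRules) (haltConstraints c n) runSchema ↔ (c.eval [n]).Dom := by
  classical
  rw [haltConstraints, runSchema, existsPQI_challenge_iff runRules_vars]
  constructor
  · rintro ⟨T, -, hrules, -, hD⟩
    have hG := isRunModel_of_holds hrules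
    set G : ℕ → ℕ → ℕ → ℕ → ℕ → Prop := fun t a b c d => [0, t, a, b, c, d] ∈ T with hGdef
    have hground : ∀ t a b c' d, groundRow t a b c' d ∈ programDemands c ++ inputDemands c n →
        G t a b c' d := by
      intro t a b c' d h
      obtain ⟨σ, hσ⟩ := hD _ h
      exact hσ
    -- Smaller elements of the order stand in column `2` of rows of the finite set `T`.
    have hlt : WellFounded fun a b => G tagLt a b 0 0 :=
      wellFounded_lt_of_isRunModel hG (s := T.image (·.getD 2 0))
        fun a b h => Finset.mem_image.2 ⟨_, h, rfl⟩
    have h0 : G tagPair 0 0 0 0 := hground _ _ _ _ _ (by simp [programDemands])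
    have hrep : RepList G [n] (encode [n]) := by
      refine ⟨n, 0, hground _ _ _ _ _ (by simp [inputDemands]), repNat_self fun i hi => ?_, rfl⟩
      refine hground _ _ _ _ _ (List.mem_append_right _ ?_)
      exact List.mem_cons_of_mem _ (List.mem_cons_of_mem _
        (List.mem_map.2 ⟨i, List.mem_range.2 hi, rfl⟩))
    obtain ⟨σ, hσ⟩ := hD _ (List.mem_append_right _ List.mem_cons_self)
    obtain ⟨w, hw, -⟩ := sound_of_isRunModel hG h0 hlt (K := (· ∈ Node.reach c))
      (num := (Node.reach c).idxOf) (Node.reach_closed c)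
      (fun k hk => hground _ _ _ _ _ (List.mem_append_left _
        (List.mem_cons_of_mem _ (List.mem_map.2 ⟨k, hk, rfl⟩))))
      (σ 0) (.of c) [n] (encode [n]) (σ 1) (Node.of_mem_reach c) hrep hσ
    exact Part.dom_iff_mem.2 ⟨w, hw⟩
  · intro h
    obtain ⟨w, hw⟩ := Part.dom_iff_mem.1 h
    obtain ⟨X, hX, r, hr⟩ := derivable_of_mem_eval c _ _ hw
    set K := Node.reach c
    -- This sum dominates every rank, every list code and every label number.
    set B := X.sup (fun p => p.1 + encode p.2.2.1 + encode p.2.2.2) + K.length with hB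
    have hXB : ∀ r k v w, (r, k, v, w) ∈ X → r ≤ B ∧ encode v ≤ B ∧ encode w ≤ B := by
      intro r k v w h
      have := Finset.le_sup (f := fun p : ℕ × Node × List ℕ × List ℕ =>
        p.1 + encode p.2.2.1 + encode p.2.2.2) h
      simp only at this
      omega
    have hKB : K.length ≤ B := Nat.le_add_left _ _
    have hG := isRunModel_certRel hX (Node.reach_closed c) hXB hKB
    obtain ⟨T, hT6, hT⟩ := exists_finset_rows (G := CertRel X K B) (B := B) (by
      rintro t a b c d ⟨ha, hb, hc, hd, h⟩
      refine ⟨?_, ha, hb, hc, hd⟩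
      by_contra! ht
      -- In the form `t + 10` the tag falls in the instruction case of `CertRow`, and instruction
      -- tags are below `10`.
      obtain ⟨t, rfl⟩ := Nat.exists_eq_add_of_le' ht
      obtain ⟨k, -, h, -⟩ := h
      have := k.instr.tag_lt
      omega)
    have hn : encode [n] ≤ B := (hXB _ _ _ _ hr).2.1
    have hnB : n ≤ B := (headI_le_encode [n]).trans hn
    have hidx : ∀ k, K.idxOf k ≤ B := fun k => List.idxOf_le_length.trans hKB
    refine ⟨T, hT6, holds_of_isRunModel hG hT, exists_matches_of_flagged fun t ht => ?_, ?_⟩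
    · exact (hT _ _ _ _ _ _).2 (Or.inr ⟨rfl, ht, rfl, rfl, rfl, rfl⟩)
    intro a ha
    have hrow : ∀ t a b c d, CertRel X K B t a b c d →
        ∃ σ, (groundRow t a b c d).map (Term.eval σ) ∈ T :=
      fun t a b c d h => ⟨fun _ => 0, (hT _ _ _ _ _ _).2 (Or.inl ⟨rfl, h⟩)⟩
    simp only [programDemands, inputDemands, List.mem_append, List.mem_cons, List.mem_map,
      List.mem_range] at ha
    rcases ha with (rfl | ⟨k, hk, rfl⟩) | (rfl | rfl | ⟨i, hi, rfl⟩)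
    · exact hrow _ _ _ _ _ ⟨by simp, by simp, by simp, by simp, [], rfl, rfl, rfl, rfl⟩
    · refine hrow _ _ _ _ _ ⟨hidx k, ?_, ?_, by simp, certRow_instr hk⟩ <;>
        cases k.instr <;> first | exact hidx _ | exact Nat.zero_le _
    · refine ⟨fun i => if i = 0 then r else encode w, (hT _ _ _ _ _ _).2 (Or.inl ⟨rfl, ?_⟩)⟩
      obtain ⟨h1, h2, h3⟩ := hXB _ _ _ _ hr
      exact ⟨h1, hidx _, h2, h3, .of c, Node.of_mem_reach c, [n], w, hr, rfl, rfl, rfl⟩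
    · exact hrow _ _ _ _ _ ⟨hnB, by simp, hn, by simp, [n], rfl, rfl, rfl, rfl⟩
    · exact hrow _ _ _ _ _ ⟨by omega, by omega, by simp, by simp, rfl, rfl, rfl⟩

theorem primrec_groundRow {α : Type*} [Primcodable α] {t a b c d : α → ℕ} (ht : Primrec t)
    (ha : Primrec a) (hb : Primrec b) (hc : Primrec c) (hd : Primrec d) :
    Primrec fun x => groundRow (t x) (a x) (b x) (c x) (d x) :=
  Primrec.list_cons.comp (.const _) <| Primrec.list_cons.comp (Primrec.sumInr.comp ht) <|
    Primrec.list_cons.comp (Primrec.sumInr.comp ha) <|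
    Primrec.list_cons.comp (Primrec.sumInr.comp hb) <|
    Primrec.list_cons.comp (Primrec.sumInr.comp hc) <|
    Primrec.list_cons.comp (Primrec.sumInr.comp hd) <| .const _

theorem primrec_haltConstraints (c : Code) : Primrec (haltConstraints c) := by
  have hn : Primrec fun n : ℕ => encode [n] :=
    Primrec.encode.comp (Primrec.list_cons.comp .id (.const []))
  have hin : Primrec (inputDemands c) := by
    refine Primrec.list_cons.comp ?_ (Primrec.list_cons.comp ?_ ?_)
    · exact Primrec.list_cons.comp (.const _) <| Primrec.list_cons.comp (.const _) <|
        Primrec.list_cons.comp (.const _) <| Primrec.list_cons.comp (.const _) <|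
        Primrec.list_cons.comp (Primrec.sumInr.comp hn) <| .const _
    · exact primrec_groundRow (.const _) .id (.const _) hn (.const _)
    · refine Primrec.list_map Primrec.list_range ?_
      exact primrec_groundRow (.const _) .snd (Primrec.succ.comp .snd) (.const _) (.const _)
  refine Primrec.list_append.comp (.const _) (Primrec.list_map ?_ ?_)
  · exact Primrec.list_append.comp (.const _) hin
  · exact Primrec.pair (.const _) (Primrec.pair (.const _) .snd)

/-- One fixed code simulates all programs on input `0`, so the call graph, the rules and the query
do not depend on the program tested. -/
theorem exists_code_halting :
    ∃ c : Code, ∀ p : Nat.Partrec.Code, (c.eval [encode p]).Dom ↔ (p.eval 0).Dom := by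
  let h : ℕ →. ℕ := fun n => (Denumerable.ofNat Nat.Partrec.Code n).eval 0
  have hh : Partrec h :=
    Nat.Partrec.Code.eval_part.comp (Computable.ofNat _) (Computable.const 0)
  obtain ⟨c, hc⟩ := Code.exists_code (Nat.Partrec'.part_iff₁.2 hh)
  refine ⟨c, fun p => ?_⟩
  have := hc ⟨[encode p], rfl⟩
  simp only at this
  rw [this]
  have h2 : h (encode p) = p.eval 0 := by simp [h]
  rw [← h2]
  rfl

end PQIProblem

theorem corollary3p12 :
    ¬ ∃ f : PQIProblem.BooleanCQ × List PQIProblem.LinearTGD × PQIProblem.Schema → Bool,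
      Computable f ∧
        ∀ (Q : PQIProblem.BooleanCQ) (C : List PQIProblem.LinearTGD) (S : PQIProblem.Schema),
          Q.IsOver S → (∀ d ∈ C, d.IsOver S) →
            (f (Q, C, S) = true ↔ PQIProblem.ExistsPQI Q C S) := by
  rintro ⟨f, hf, hspec⟩
  obtain ⟨c, hc⟩ := PQIProblem.exists_code_halting
  -- Query and schema are constant; the program enters only through the demanded rows for its code
  -- number, which are primitive recursive in that number.
  refine ComputablePred.halting_problem 0 (ComputablePred.computable_iff.2
    ⟨fun p => f (PQIProblem.challengeQuery PQIProblem.runRules,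
      PQIProblem.haltConstraints c (Encodable.encode p), PQIProblem.runSchema), ?_, ?_⟩)
  · exact hf.comp ((Computable.const _).pair
      (((PQIProblem.primrec_haltConstraints c).to_comp.comp Computable.encode).pair
        (Computable.const _)))
  · funext p
    refine propext ?_
    rw [← hc, ← PQIProblem.existsPQI_haltConstraints_iff]
    refine (hspec _ _ _ (PQIProblem.challengeQuery_isOver PQIProblem.runRules_head_length)
      fun d hd => ?_).symm
    rcases List.mem_append.1 hd with hd | hd
    · exact PQIProblem.challengeConstraints_isOver PQIProblem.runRules_body_length d hd
    · exact PQIProblem.demandConstraints_isOver (PQIProblem.demands_length c _) d hd
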